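/- Let $A$ be a finite-dimensional algebra over a field $K$. Modules are finite-dimensional right $A$-modules. The dominant dimension of a module $M$ with minimal injective resolution $0\to M\to I_0\to I_1\to\cdots$ is $\sup\{n\ge 0 : I_i \text{ is projective for } i=0,\dots,n\}+1\in\{1,2,\dots,\infty\}$ if $I_0$ is projective, and $0$ otherwise; the dominant dimension of $A$ is that of the right module $A_A$. Write $\mathrm{Dom}_n$ for the class of modules of dominant dimension at least $n$. A module $M$ is called Gorenstein projective if $\mathrm{Ext}^i_A(M,A)=0=\mathrm{Ext}^i_{A^{op}}(\mathrm{Tr}(M),A)$ for all $i\ge 1$, where the transpose $\mathrm{Tr}(M)$ is the left module $\mathrm{coker}(\mathrm{Hom}_A(P_0,A)\to \mathrm{Hom}_A(P_1,A))$ for a minimal projective presentation $P_1\to P_0\to M\to 0$; write $Gp(A)$ for the class of Gorenstein projective modules. The algebra $A$ is Gorenstein with Gorenstein dimension $g\in\mathbb{N}$ if the injective dimensions of $A$ as a left module and as a right module are both equal to $g$. Suppose that $A$ has (finite) dominant dimension $d\ge 1$. Then the following two statements are equivalent: (1) $Gp(A)=\mathrm{Dom}_d$; (2) $A$ is Gorenstein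 with Gorenstein dimension $d$. -/

import Mathlib

universe u v

open CategoryTheory

namespace GorDom

/-- A submodule `N` of `M` is essential: it meets every nonzero submodule nontrivially. -/
def IsEssentialSubmodule {R M : Type*} [Ring R] [AddCommGroup M] [Module R M]
    (N : Submodule R M) : Prop :=
  ∀ L : Submodule R M, N ⊓ L = ⊥ → L = ⊥

/-- A submodule `N` of `M` is superfluous (small): `N + L = M` forces `L = M`. -/
def IsSuperfluousSubmodule {R M : Type*} [Ring R] [AddCommGroup M] [Module R M]
    (N : Submodule R M) : Prop :=
  ∀ L : Submodule R M, N ⊔ L = ⊤ → L = ⊤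

/-- An injective resolution `0 → M → I₀ → I₁ → ⋯` is minimal if `Iᵢ` is an essential extension
(i.e. an injective hull) of the kernel of `Iᵢ → Iᵢ₊₁` for every `i`. By exactness this kernel is
the image of `M` if `i = 0`, and the image of `Iᵢ₋₁` otherwise. -/
def IsMinimalResolution {R : Type u} [Ring R] {M : ModuleCat.{u} R}
    (I : InjectiveResolution M) : Prop :=
  ∀ i : ℕ, IsEssentialSubmodule (LinearMap.ker (I.cocomplex.d i (i + 1)).hom)

/-- The dominant dimension of a module `M`: the supremum of all `k` such that the first `k` terms
`I₀, …, Iₖ₋₁` of a minimal injective resolution of `M` are projective. Minimal injective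
resolutions are unique up to isomorphism. -/
noncomputable def domdim {R : Type u} [Ring R] (M : ModuleCat.{u} R) : ℕ∞ :=
  sSup {n : ℕ∞ | ∃ k : ℕ, n = k ∧ ∃ I : InjectiveResolution M, IsMinimalResolution I ∧
    ∀ i < k, Module.Projective R (I.cocomplex.X i)}

/-- The regular right module `A_A`. Right `A`-modules are modules over `Aᵐᵒᵖ`. -/
abbrev rightRegular (A : Type u) [Ring A] : ModuleCat.{u} Aᵐᵒᵖ := ModuleCat.of Aᵐᵒᵖ A

/-- The regular left module `_A A`. -/
abbrev leftRegular (A : Type u) [Ring A] : ModuleCat.{u} A := ModuleCat.of A A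

/-- The dominant dimension of an algebra is that of its regular right module. -/
noncomputable def algDomdim (A : Type u) [Ring A] : ℕ∞ := domdim (rightRegular A)

/-- `Dom_n(A)`: the finitely generated right `A`-modules of dominant dimension at least `n`. Over
a finite-dimensional algebra, finitely generated is the same as finite-dimensional. -/
def Dom (A : Type u) [Ring A] (n : ℕ∞) : ObjectProperty (ModuleCat.{u} Aᵐᵒᵖ) :=
  fun M => Module.Finite Aᵐᵒᵖ M ∧ n ≤ domdim M

/-- A minimal projective presentation `P₁ → P₀ → M → 0` of the right `A`-module `M`: an exact
sequence in which `P₀ → M` and `P₁ → ker (P₀ → M)` are projective covers. -/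
structure MinimalPresentation {A : Type u} [Ring A] (M : ModuleCat.{u} Aᵐᵒᵖ) where
  P₁ : ModuleCat.{u} Aᵐᵒᵖ
  P₀ : ModuleCat.{u} Aᵐᵒᵖ
  projective₁ : Module.Projective Aᵐᵒᵖ P₁
  projective₀ : Module.Projective Aᵐᵒᵖ P₀
  f : P₁ →ₗ[Aᵐᵒᵖ] P₀
  π : P₀ →ₗ[Aᵐᵒᵖ] M
  surjective : Function.Surjective π
  exact : LinearMap.range f = LinearMap.ker π
  superfluous₀ : IsSuperfluousSubmodule (LinearMap.ker π)
  superfluous₁ : IsSuperfluousSubmodule (LinearMap.ker f)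

/-- The transpose `Tr M`: the left `A`-module which is the cokernel of
`Hom_A(f, A) : Hom_A(P₀, A) → Hom_A(P₁, A)`, for a minimal projective presentation
`P₁ → P₀ → M → 0` with first map `f`. -/
noncomputable def MinimalPresentation.transpose {A : Type u} [Ring A] {M : ModuleCat.{u} Aᵐᵒᵖ}
    (p : MinimalPresentation M) : ModuleCat.{u} A :=
  ModuleCat.of A ((p.P₁ →ₗ[Aᵐᵒᵖ] A) ⧸ LinearMap.range (LinearMap.lcomp A A p.f))

/-- `Gp(A)`: the finitely generated right `A`-modules `M` with
`Extⁱ(M, A) = 0 = Extⁱ(Tr M, A)` for all `i ≥ 1`, where the first `Ext` is over right modules and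
the second one over left modules. Minimal projective presentations exist over finite-dimensional
algebras and are unique up to isomorphism. -/
def Gp (A : Type u) [Ring A] : ObjectProperty (ModuleCat.{u} Aᵐᵒᵖ) :=
  fun M => Module.Finite Aᵐᵒᵖ M ∧
    (∀ i : ℕ, 1 ≤ i → Subsingleton (Abelian.Ext M (rightRegular A) i)) ∧
    ∃ p : MinimalPresentation M,
      ∀ i : ℕ, 1 ≤ i → Subsingleton (Abelian.Ext p.transpose (leftRegular A) i)

/-- `A` is Gorenstein of Gorenstein dimension `g`: the left and the right injective dimension of
`A` are both equal to the natural number `g`. -/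
def IsGorensteinOfDim (A : Type u) [Ring A] (g : ℕ) : Prop :=
  injectiveDimension (leftRegular A) = g ∧ injectiveDimension (rightRegular A) = g

end GorDom

/-!
Call a module torsion if it has no nonzero map to a projective-injective module. Then `M` has
dominant dimension at least `n` if and only if `Extⁱ(T, M) = 0` for all torsion `T` and all `i < n`,
so that dominant dimension can be followed along long exact sequences.

If `A` is Gorenstein of dimension `d`, Gorenstein projective modules are `d`-th syzygies, hence lie
in `Dom_d`. Conversely a module in `Dom_d` is a `d`-th syzygy through projective-injective modules,
and the transpose of a module `M` with `Extⁱ(M, A) = 0` for `i ≥ 1` is a syzygy of any order, so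
that `id A ≤ d` on both sides makes the modules in `Dom_d` Gorenstein projective.

If `Gp(A) = Dom_d`, then `d`-th syzygies are Gorenstein projective, which bounds the right injective
dimension of `A` by `d`. The `d`-th syzygy of `D(A) = Hom_K(A, K)` is moreover projective, which
bounds the left one by duality. The bounds are sharp: with `id A_A < d` the minimal injective
resolution of `A_A` would consist of projectives only and the dominant dimension would be infinite,
and `id _AA < d` would imply `id A_A < d`, since `Extⁱ(D(A), A)` then vanishes for `i ≥ d`.
-/

namespace GorDom

open Abelian

section AbelianCategory

variable {C : Type*} [Category* C] [Abelian C]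

/-- `0 ⟶ X ⟶ Y ⟶ Z ⟶ 0` is a short exact sequence. This is `ShortComplex.ShortExact` as a predicate
on two morphisms, so that short exact sequences with prescribed ends can be quantified over. -/
def IsShortExact {X Y Z : C} (f : X ⟶ Y) (g : Y ⟶ Z) : Prop :=
  ∃ w : f ≫ g = 0, (ShortComplex.mk f g w).ShortExact

lemma IsShortExact.mono {X Y Z : C} {f : X ⟶ Y} {g : Y ⟶ Z} (h : IsShortExact f g) : Mono f :=
  h.choose_spec.mono_f

lemma IsShortExact.epi {X Y Z : C} {f : X ⟶ Y} {g : Y ⟶ Z} (h : IsShortExact f g) : Epi g :=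
  h.choose_spec.epi_g

/-- `IsSyzygy 𝒬 n X Y` says that `Y` is an `n`-th syzygy of `X` by objects with property `𝒬`: there
is an exact sequence `0 ⟶ Y ⟶ Pₙ₋₁ ⟶ ⋯ ⟶ P₀ ⟶ X ⟶ 0` with all `Pᵢ` in `𝒬`. Equivalently, `X` is an
`n`-th cosyzygy of `Y`; both readings are used, according to whether the `Pᵢ` are projective or
injective. -/
inductive IsSyzygy (𝒬 : ObjectProperty C) : ℕ → C → C → Prop
  | zero (X : C) : IsSyzygy 𝒬 0 X X
  | succ {n : ℕ} {X K P Y : C} {j : Y ⟶ P} {q : P ⟶ K} (hjq : IsShortExact j q) (hP : 𝒬 P)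
      (hK : IsSyzygy 𝒬 n X K) : IsSyzygy 𝒬 (n + 1) X Y

variable {X Y : C} {n : ℕ} {𝒬 𝒬' : ObjectProperty C}

lemma exists_isSyzygy_of_forall_cosyzygy {𝒳 : ObjectProperty C}
    (H : ∀ Y, 𝒳 Y → ∃ (P K : C) (j : Y ⟶ P) (q : P ⟶ K), IsShortExact j q ∧ 𝒬 P ∧ 𝒳 K) (n : ℕ)
    (hY : 𝒳 Y) : ∃ X, 𝒳 X ∧ IsSyzygy 𝒬 n X Y := by
  induction n generalizing Y with
  | zero => exact ⟨Y, hY, .zero Y⟩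
  | succ n ih =>
    obtain ⟨P, K, j, q, hjq, hP, hK⟩ := H Y hY
    obtain ⟨X, hX, hXK⟩ := ih hK
    exact ⟨X, hX, .succ hjq hP hXK⟩

lemma exists_isSyzygy_of_forall_syzygy {𝒳 : ObjectProperty C}
    (H : ∀ X, 𝒳 X → ∃ (K P : C) (j : K ⟶ P) (q : P ⟶ X), IsShortExact j q ∧ 𝒬 P ∧ 𝒳 K) (n : ℕ)
    (hX : 𝒳 X) : ∃ Y, 𝒳 Y ∧ IsSyzygy 𝒬 n X Y := by
  induction n with
  | zero => exact ⟨X, hX, .zero X⟩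
  | succ n ih =>
    obtain ⟨K, hK, hXK⟩ := ih
    obtain ⟨Y, P, j, q, hjq, hP, hY⟩ := H K hK
    exact ⟨Y, hY, .succ hjq hP hXK⟩

lemma IsSyzygy.mono (h𝒬 : 𝒬 ≤ 𝒬') (h : IsSyzygy 𝒬 n X Y) : IsSyzygy 𝒬' n X Y := by
  induction h with
  | zero X => exact .zero X
  | succ hjq hP _ ih => exact .succ hjq (h𝒬 _ hP) ih

lemma exists_projective_isShortExact [EnoughProjectives C] (X : C) :
    ∃ (K P : C) (j : K ⟶ P) (q : P ⟶ X), IsShortExact j q ∧ Projective P :=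
  ⟨_, _, _, Projective.π X, ⟨Limits.kernel.condition _,
    .mk' (ShortComplex.exact_kernel _) inferInstance inferInstance⟩, inferInstance⟩

variable [HasExt.{v} C]

/-- `Extⁱ(X, Y) = 0`. -/
abbrev ExtVanish (X Y : C) (i : ℕ) : Prop := Subsingleton (Ext X Y i)

variable {W Z M P E : C} {i : ℕ}

lemma extVanish_zero_iff : ExtVanish X Y 0 ↔ ∀ f : X ⟶ Y, f = 0 :=
  Ext.homEquiv₀.subsingleton_congr.trans (subsingleton_iff_forall_eq 0)

lemma extVanish_of_projective [Projective P] (hi : 1 ≤ i) : ExtVanish P Z i := by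
  obtain ⟨i, rfl⟩ := Nat.exists_eq_add_of_le' hi
  exact Ext.subsingleton_of_projective P Z i

lemma extVanish_of_injective [Injective E] (hi : 1 ≤ i) : ExtVanish W E i := by
  obtain ⟨i, rfl⟩ := Nat.exists_eq_add_of_le' hi
  exact Ext.subsingleton_of_injective W E i

lemma extVanish_of_hasInjectiveDimensionLT (hY : HasInjectiveDimensionLT Y n) (hi : n ≤ i) :
    ExtVanish W Y i :=
  HasInjectiveDimensionLT.subsingleton (hX := hY) Y n i hi W

lemma ExtVanish.of_retract_left (h : ExtVanish X Z i) (r : Retract Y X) : ExtVanish Y Z i := by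
  refine subsingleton_of_forall_eq 0 fun a => ?_
  rw [← Ext.mk₀_id_comp a, ← r.retract, ← Ext.mk₀_comp_mk₀_assoc, h.elim (Ext.comp _ a _) 0,
    Ext.comp_zero]

lemma ExtVanish.of_retract_right (h : ExtVanish W X i) (r : Retract Y X) : ExtVanish W Y i := by
  refine subsingleton_of_forall_eq 0 fun a => ?_
  rw [← Ext.comp_mk₀_id a, ← r.retract, ← Ext.mk₀_comp_mk₀, ← Ext.comp_assoc_of_third_deg_zero,
    h.elim (a.comp _ _) 0, Ext.zero_comp]

namespace IsShortExact

variable {f : X ⟶ Y} {g : Y ⟶ Z} (h : IsShortExact f g)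

include h

lemma extVanish_covariant₁ (hZ : ExtVanish W Z i) (hY : ExtVanish W Y (i + 1)) :
    ExtVanish W X (i + 1) := by
  refine subsingleton_of_forall_eq 0 fun a => ?_
  obtain ⟨b, rfl⟩ := Ext.covariant_sequence_exact₁ W h.choose_spec a (Subsingleton.elim _ _) rfl
  rw [hZ.elim b 0, Ext.zero_comp]

lemma extVanish_covariant₃ (hY : ExtVanish W Y i) (hX : ExtVanish W X (i + 1)) :
    ExtVanish W Z i := by
  refine subsingleton_of_forall_eq 0 fun a => ?_
  obtain ⟨b, rfl⟩ := Ext.covariant_sequence_exact₃ W h.choose_spec a rfl (Subsingleton.elim _ _)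
  rw [hY.elim b 0, Ext.zero_comp]

lemma extVanish_contravariant₁ (hY : ExtVanish Y W i) (hZ : ExtVanish Z W (i + 1)) :
    ExtVanish X W i := by
  refine subsingleton_of_forall_eq 0 fun a => ?_
  obtain ⟨b, rfl⟩ := Ext.contravariant_sequence_exact₁ h.choose_spec W a (add_comm 1 i)
    (Subsingleton.elim _ _)
  rw [hY.elim b 0, Ext.comp_zero]

lemma extVanish_contravariant₃ (hX : ExtVanish X W i) (hY : ExtVanish Y W (i + 1)) :
    ExtVanish Z W (i + 1) := by
  refine subsingleton_of_forall_eq 0 fun a => ?_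
  obtain ⟨b, rfl⟩ := Ext.contravariant_sequence_exact₃ h.choose_spec W a (Subsingleton.elim _ _)
    (add_comm 1 i)
  rw [hX.elim b 0, Ext.comp_zero]

lemma extVanish_zero (hY : ExtVanish W Y 0) : ExtVanish W X 0 := by
  have := h.mono
  rw [extVanish_zero_iff] at hY ⊢
  exact fun a => (cancel_mono f).1 ((hY _).trans Limits.zero_comp.symm)

lemma exists_extension (hZ : ExtVanish Z W 1) (a : X ⟶ W) : ∃ b : Y ⟶ W, f ≫ b = a := by
  obtain ⟨b, hb⟩ := Ext.contravariant_sequence_exact₁ h.choose_spec W (Ext.mk₀ a) (add_zero 1)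
    (Subsingleton.elim _ _)
  obtain ⟨b, rfl⟩ := (Ext.mk₀_bijective _ _).2 b
  rw [Ext.mk₀_comp_mk₀] at hb
  exact ⟨b, (Ext.mk₀_bijective _ _).1 hb⟩

lemma extVanish_one_of_exists_extension (hY : ExtVanish Y W 1)
    (H : ∀ a : X ⟶ W, ∃ b : Y ⟶ W, f ≫ b = a) : ExtVanish Z W 1 := by
  obtain ⟨w, hS⟩ := h
  refine subsingleton_of_forall_eq 0 fun c => ?_
  obtain ⟨a, rfl⟩ := Ext.contravariant_sequence_exact₃ hS W c (Subsingleton.elim _ _)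
    (add_zero 1)
  obtain ⟨a, rfl⟩ := (Ext.mk₀_bijective _ _).2 a
  obtain ⟨b, rfl⟩ := H a
  rw [← Ext.mk₀_comp_mk₀, ShortComplex.ShortExact.extClass_comp_assoc]

lemma extVanish_one_of_exists_lift (hY : ExtVanish W Y 1)
    (H : ∀ a : W ⟶ Z, ∃ b : W ⟶ Y, b ≫ g = a) : ExtVanish W X 1 := by
  obtain ⟨w, hS⟩ := h
  refine subsingleton_of_forall_eq 0 fun c => ?_
  obtain ⟨a, rfl⟩ := Ext.covariant_sequence_exact₁ W hS c (Subsingleton.elim _ _)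
    (zero_add 1)
  obtain ⟨a, rfl⟩ := (Ext.mk₀_bijective _ _).2 a
  obtain ⟨b, rfl⟩ := H a
  rw [← Ext.mk₀_comp_mk₀, Ext.comp_assoc_of_second_deg_zero]
  exact (congrArg ((Ext.mk₀ b).comp · (zero_add 1)) hS.comp_extClass).trans (Ext.comp_zero ..)

lemma nonempty_retract (hZ : ExtVanish Z X 1) : Nonempty (Retract X Y) := by
  obtain ⟨r, hr⟩ := h.exists_extension hZ (𝟙 X)
  exact ⟨⟨f, r, hr⟩⟩

end IsShortExact

namespace IsSyzygy

lemma extVanish_left_iff (h : IsSyzygy 𝒬 n X Y) (h𝒬 : ∀ P, 𝒬 P → ∀ i, 1 ≤ i → ExtVanish P Z i)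
    (hi : 1 ≤ i) : ExtVanish Y Z i ↔ ExtVanish X Z (i + n) := by
  induction h generalizing i with
  | zero X => rfl
  | @succ n X K P Y j q hjq hP _ ih =>
    rw [Nat.add_left_comm, Nat.add_comm n, ← ih (by lia : 1 ≤ i + 1)]
    exact ⟨fun hY => hjq.extVanish_contravariant₃ hY (h𝒬 P hP _ (by lia)),
      hjq.extVanish_contravariant₁ (h𝒬 P hP i hi)⟩

lemma extVanish_right_iff (h : IsSyzygy 𝒬 n X Y) (h𝒬 : ∀ P, 𝒬 P → ∀ i, 1 ≤ i → ExtVanish W P i)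
    (hi : 1 ≤ i) : ExtVanish W X i ↔ ExtVanish W Y (i + n) := by
  induction h with
  | zero X => rfl
  | succ hjq hP _ ih =>
    exact ih.trans ⟨fun hK => hjq.extVanish_covariant₁ hK (h𝒬 _ hP _ (by lia)),
      hjq.extVanish_covariant₃ (h𝒬 _ hP _ (by lia))⟩

end IsSyzygy

/-- An object is torsion if it has no nonzero morphism to a projective-injective object. -/
def IsTorsion (T : C) : Prop := ∀ Q : C, Projective Q → Injective Q → ∀ f : T ⟶ Q, f = 0

/-- The homological form of "the dominant dimension of `M` is at least `n`": the groups `Extⁱ(T, M)`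
vanish for all torsion objects `T` and all `i < n`. -/
def HasDominantDimensionGE (M : C) (n : ℕ) : Prop := ∀ T : C, IsTorsion T → ∀ i < n, ExtVanish T M i

namespace HasDominantDimensionGE

lemma mono {m : ℕ} (h : HasDominantDimensionGE M n) (hmn : m ≤ n) : HasDominantDimensionGE M m :=
  fun T hT i hi => h T hT i (hi.trans_le hmn)

lemma of_projective_of_injective [hP : Projective E] [hI : Injective E] (n : ℕ) :
    HasDominantDimensionGE E n := by
  rintro T hT (_ | i) -
  · exact extVanish_zero_iff.2 (hT E hP hI)
  · exact extVanish_of_injective (by lia)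

variable {f : X ⟶ Y} {g : Y ⟶ Z}

lemma of_isShortExact (h : IsShortExact f g) (hY : HasDominantDimensionGE Y (n + 1))
    (hZ : HasDominantDimensionGE Z n) : HasDominantDimensionGE X (n + 1) := by
  rintro T hT (_ | i) hi
  · exact h.extVanish_zero (hY T hT 0 hi)
  · exact h.extVanish_covariant₁ (hZ T hT i (by lia)) (hY T hT _ hi)

lemma quotient (h : IsShortExact f g) (hY : HasDominantDimensionGE Y n)
    (hX : HasDominantDimensionGE X (n + 1)) : HasDominantDimensionGE Z n :=
  fun T hT i hi => h.extVanish_covariant₃ (hY T hT i hi) (hX T hT _ (by lia))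

end HasDominantDimensionGE

lemma IsSyzygy.hasDominantDimensionGE {m : ℕ} (h : IsSyzygy 𝒬 n X Y)
    (h𝒬 : ∀ P, 𝒬 P → HasDominantDimensionGE P (m + n)) (hX : HasDominantDimensionGE X m) :
    HasDominantDimensionGE Y (m + n) := by
  induction h with
  | zero X => exact hX
  | succ hjq hP _ ih =>
    exact .of_isShortExact hjq (h𝒬 _ hP) (ih (fun P hP => (h𝒬 P hP).mono (by lia)) hX)

end AbelianCategory

section SplicedResolution

variable {C : Type*} [Category* C] [Abelian C]

namespace IsShortExact

lemma exact_of_eq_comp {X₁ X₂ X₃ X₄ X₅ : C} {q₁ : X₁ ⟶ X₂} {j₂ : X₂ ⟶ X₃} {q₂ : X₃ ⟶ X₄}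
    {j₃ : X₄ ⟶ X₅} (h : IsShortExact j₂ q₂) (hq₁ : Epi q₁) (hj₃ : Mono j₃) {f : X₁ ⟶ X₃}
    {g : X₃ ⟶ X₅} (hf : f = q₁ ≫ j₂) (hg : g = q₂ ≫ j₃) (w : f ≫ g = 0) :
    (ShortComplex.mk f g w).Exact := by
  obtain ⟨w', hS⟩ := h
  subst hf hg
  let S := ShortComplex.mk (q₁ ≫ j₂) q₂ (by rw [Category.assoc, w', Limits.comp_zero])
  let φ : S ⟶ ShortComplex.mk j₂ q₂ w' := { τ₁ := q₁, τ₂ := 𝟙 X₃, τ₃ := 𝟙 X₄ }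
  let ψ : S ⟶ ShortComplex.mk (q₁ ≫ j₂) (q₂ ≫ j₃) w := { τ₁ := 𝟙 X₁, τ₂ := 𝟙 X₃, τ₃ := j₃ }
  have : Epi φ.τ₁ := hq₁
  have : Mono ψ.τ₃ := hj₃
  exact (ShortComplex.exact_iff_of_epi_of_isIso_of_mono ψ).1
    ((ShortComplex.exact_iff_of_epi_of_isIso_of_mono φ).2 hS.exact)

end IsShortExact

variable {N E : ℕ → C} {j : ∀ i, N i ⟶ E i} {q : ∀ i, E i ⟶ N (i + 1)}
  (h : ∀ i, IsShortExact (j i) (q i))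

/-- The cochain complex `E 0 ⟶ E 1 ⟶ ⋯` spliced from short exact sequences
`0 ⟶ N i ⟶ E i ⟶ N (i + 1) ⟶ 0`. -/
noncomputable def splicedComplex : CochainComplex C ℕ :=
  CochainComplex.of E (fun i => q i ≫ j (i + 1)) fun i => by
    rw [Category.assoc, ← Category.assoc (j (i + 1)), (h (i + 1)).choose, Limits.zero_comp,
      Limits.comp_zero]

lemma splicedComplex_d (i : ℕ) : (splicedComplex h).d i (i + 1) = q i ≫ j (i + 1) := by
  simp [splicedComplex]

lemma splicedComplex_exactAt_succ (i : ℕ) : (splicedComplex h).ExactAt (i + 1) := by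
  rw [HomologicalComplex.exactAt_iff' _ i (i + 1) (i + 1 + 1) (by simp) (by simp)]
  exact (h (i + 1)).exact_of_eq_comp (h i).epi (h (i + 2)).mono (splicedComplex_d h i)
    (splicedComplex_d h (i + 1)) _

lemma comp_splicedComplex_d : j 0 ≫ (splicedComplex h).d 0 1 = 0 := by
  have w : j 0 ≫ q 0 ≫ j 1 = 0 := by rw [← Category.assoc, (h 0).choose, Limits.zero_comp]
  exact (congrArg (j 0 ≫ ·) (splicedComplex_d h 0)).trans w

lemma exact_comp_splicedComplex_d :
    (ShortComplex.mk (j 0) ((splicedComplex h).d 0 1) (comp_splicedComplex_d h)).Exact :=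
  (h 0).exact_of_eq_comp inferInstance (h 1).mono (Category.id_comp _).symm (splicedComplex_d h 0) _

/-- The injective resolution spliced from short exact sequences `0 ⟶ N i ⟶ E i ⟶ N (i + 1) ⟶ 0` with
all `E i` injective. -/
noncomputable def splicedResolution [∀ i, Injective (E i)] : InjectiveResolution (N 0) where
  cocomplex := splicedComplex h
  injective i := inferInstanceAs (Injective (E i))
  ι := (CochainComplex.fromSingle₀Equiv _ _).symm ⟨j 0, comp_splicedComplex_d h⟩
  quasiIso := ⟨fun i => by
    cases i
    · rw [CochainComplex.quasiIsoAt₀_iff, ShortComplex.quasiIso_iff_of_zeros]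
      · refine (ShortComplex.exact_and_mono_f_iff_of_iso ?_).2
          ⟨exact_comp_splicedComplex_d h, (h 0).mono⟩
        exact ShortComplex.isoMk (Iso.refl _) (Iso.refl _) (Iso.refl _)
          (by
            refine (Category.id_comp _).trans (Eq.trans ?_ (Category.comp_id _).symm)
            exact (CochainComplex.fromSingle₀Equiv_symm_apply_f_zero (C := splicedComplex h) (j 0)
              (comp_splicedComplex_d h)).symm)
          ((Category.id_comp _).trans (Category.comp_id _).symm)
      all_goals rfl
    · rw [quasiIsoAt_iff_exactAt]
      · apply splicedComplex_exactAt_succ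
      · apply CochainComplex.exactAt_succ_single_obj⟩

end SplicedResolution

section ModuleCat

variable {R : Type u} [Ring R]

lemma isShortExact_iff {X Y Z : ModuleCat.{u} R} {f : X ⟶ Y} {g : Y ⟶ Z} : IsShortExact f g ↔
    Function.Injective f ∧ Function.Exact f g ∧ Function.Surjective g := by
  refine ⟨fun ⟨w, hS⟩ => ⟨(ModuleCat.mono_iff_injective f).1 hS.mono_f,
    (ShortComplex.ShortExact.moduleCat_exact_iff_function_exact _).1 hS.exact,
    (ModuleCat.epi_iff_surjective g).1 hS.epi_g⟩, fun ⟨hf, hfg, hg⟩ => ?_⟩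
  refine ⟨ModuleCat.hom_ext hfg.linearMap_comp_eq_zero, .mk' ?_
    ((ModuleCat.mono_iff_injective f).2 hf) ((ModuleCat.epi_iff_surjective g).2 hg)⟩
  exact (ShortComplex.ShortExact.moduleCat_exact_iff_function_exact _).2 hfg

lemma isShortExact_mkQ {X Y : ModuleCat.{u} R} (f : X ⟶ Y) [hf : Mono f] :
    IsShortExact f (ModuleCat.ofHom (LinearMap.range f.hom).mkQ) :=
  isShortExact_iff.2 ⟨(ModuleCat.mono_iff_injective f).1 hf, LinearMap.exact_map_mkQ_range f.hom,
    Submodule.mkQ_surjective _⟩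

lemma isShortExact_subtype {X Y : ModuleCat.{u} R} (f : X ⟶ Y) [hf : Epi f] :
    IsShortExact (ModuleCat.ofHom (LinearMap.ker f.hom).subtype) f :=
  isShortExact_iff.2 ⟨Submodule.injective_subtype _, LinearMap.exact_subtype_ker_map f.hom,
    (ModuleCat.epi_iff_surjective f).1 hf⟩

lemma exists_desc_of_exact {X Y Z W : ModuleCat.{u} R} {f : X ⟶ Y}
    {π : Y ⟶ Z} (h : Function.Exact f π) (hπ : Function.Surjective π) (φ : Y ⟶ W)
    (hφ : f ≫ φ = 0) : ∃ j : Z ⟶ W, π ≫ j = φ := by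
  have : Epi π := (ModuleCat.epi_iff_surjective π).2 hπ
  have hS : (ShortComplex.mk f π (ModuleCat.hom_ext h.linearMap_comp_eq_zero)).Exact :=
    (ShortComplex.ShortExact.moduleCat_exact_iff_function_exact _).2 h
  exact ⟨hS.desc φ hφ, hS.g_desc φ hφ⟩

/-- The finitely generated projective modules. -/
def fgProjective (R : Type u) [Ring R] : ObjectProperty (ModuleCat.{u} R) :=
  fun P => Module.Finite R P ∧ Projective P

/-- The finitely generated injective modules. -/
def fgInjective (R : Type u) [Ring R] : ObjectProperty (ModuleCat.{u} R) :=
  fun E => Module.Finite R E ∧ Injective E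

lemma fgProjective_pi (n : ℕ) : fgProjective R (ModuleCat.of R (Fin n → R)) :=
  ⟨inferInstanceAs (Module.Finite R (Fin n → R)), (IsProjective.iff_projective _).1 inferInstance⟩

lemma fgProjective.extVanish {P Y : ModuleCat.{u} R} (hP : fgProjective R P) {i : ℕ} (hi : 1 ≤ i) :
    ExtVanish P Y i :=
  have := hP.2
  extVanish_of_projective hi

lemma fgProjective.exists_retract {P : ModuleCat.{u} R} (hP : fgProjective R P) :
    ∃ n : ℕ, Nonempty (Retract P (ModuleCat.of R (Fin n → R))) := by
  obtain ⟨_, hP⟩ := hP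
  have : Module.Projective R P := (IsProjective.iff_projective P).2 hP
  obtain ⟨n, r, s, -, -, hrs⟩ := Module.Finite.exists_comp_eq_id_of_projective R P
  exact ⟨n, ⟨⟨ModuleCat.ofHom s, ModuleCat.ofHom r, ModuleCat.hom_ext hrs⟩⟩⟩

lemma ExtVanish.pi_right {X Y : ModuleCat.{u} R} {i : ℕ} (h : ExtVanish X Y i) (n : ℕ) :
    ExtVanish X (ModuleCat.of R (Fin n → Y)) i :=
  have : ExtVanish X (⨁ fun _ : Fin n => Y) i :=
    (Ext.addEquivBiproduct X (Limits.biproduct.isBilimit _) i).subsingleton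
  this.of_retract_right (.ofIso (ModuleCat.biproductIsoPi fun _ => Y).symm)

lemma ExtVanish.of_fgProjective {X P : ModuleCat.{u} R} {i : ℕ}
    (h : ExtVanish X (ModuleCat.of R R) i) (hP : fgProjective R P) : ExtVanish X P i := by
  obtain ⟨n, ⟨r⟩⟩ := hP.exists_retract
  exact (h.pi_right n).of_retract_right r

lemma exists_fgProjective_isShortExact [IsNoetherianRing R] (X : ModuleCat.{u} R)
    [Module.Finite R X] : ∃ (K P : ModuleCat.{u} R) (j : K ⟶ P) (q : P ⟶ X),
      IsShortExact j q ∧ fgProjective R P ∧ Module.Finite R K := by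
  obtain ⟨n, p, hp⟩ := Module.Finite.exists_fin' R X
  have : Epi (ModuleCat.ofHom p) := (ModuleCat.epi_iff_surjective _).2 hp
  exact ⟨_, _, _, _, isShortExact_subtype (ModuleCat.ofHom p), fgProjective_pi n,
    inferInstanceAs (Module.Finite R (LinearMap.ker p))⟩

lemma exists_isSyzygy_fgProjective [IsNoetherianRing R] (n : ℕ) (X : ModuleCat.{u} R)
    [hX : Module.Finite R X] :
    ∃ Y : ModuleCat.{u} R, Module.Finite R Y ∧ IsSyzygy (fgProjective R) n X Y :=
  exists_isSyzygy_of_forall_syzygy (𝒳 := fun X : ModuleCat.{u} R => Module.Finite R X)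
    (fun X _ => exists_fgProjective_isShortExact X) n hX

/-- Rings over which every finitely generated module embeds into a finitely generated injective
module, for example finite-dimensional algebras over a field. -/
class EnoughFiniteInjectives (R : Type u) [Ring R] : Prop where
  exists_mono (M : ModuleCat.{u} R) [Module.Finite R M] :
    ∃ (E : ModuleCat.{u} R) (j : M ⟶ E), Mono j ∧ fgInjective R E

lemma exists_isSyzygy_fgInjective [EnoughFiniteInjectives R] (n : ℕ) (Y : ModuleCat.{u} R)
    [hY : Module.Finite R Y] :
    ∃ X : ModuleCat.{u} R, Module.Finite R X ∧ IsSyzygy (fgInjective R) n X Y := by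
  refine exists_isSyzygy_of_forall_cosyzygy
    (𝒳 := fun X : ModuleCat.{u} R => Module.Finite R X) (fun Y _ => ?_) n hY
  obtain ⟨E, j, _, hE⟩ := EnoughFiniteInjectives.exists_mono Y
  have := hE.1
  exact ⟨E, _, j, _, isShortExact_mkQ j, hE,
    inferInstanceAs (Module.Finite R (E ⧸ LinearMap.range j.hom))⟩

end ModuleCat

section HullsAndCovers

variable {R : Type u} [Ring R]

section Fitting

variable {E P : Type u} [AddCommGroup E] [Module R E] [AddCommGroup P] [Module R P]

lemma exists_pos_isCompl_ker_pow_range_pow [IsArtinian R E] [IsNoetherian R E]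
    (φ : Module.End R E) :
    ∃ n, 0 < n ∧ IsCompl (LinearMap.ker (φ ^ n)) (LinearMap.range (φ ^ n)) :=
  ((Filter.eventually_gt_atTop 0).and φ.eventually_isCompl_ker_pow_range_pow).exists

lemma nonempty_retract_of_isCompl {F G : Submodule R E} (h : IsCompl F G) :
    Nonempty (Retract (ModuleCat.of R F) (ModuleCat.of R E)) :=
  ⟨⟨ModuleCat.ofHom F.subtype, ModuleCat.ofHom (F.projectionOnto G h),
    ModuleCat.hom_ext (Submodule.projectionOnto_comp_subtype h)⟩⟩

lemma injective_of_isCompl [hE : Module.Injective R E] {F G : Submodule R E} (h : IsCompl F G) :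
    Module.Injective R F := by
  rw [Module.injective_iff_injective_object] at hE ⊢
  exact (nonempty_retract_of_isCompl h).some.injective

lemma projective_of_isCompl [hE : Module.Projective R E] {F G : Submodule R E} (h : IsCompl F G) :
    Module.Projective R F := by
  rw [IsProjective.iff_projective] at hE ⊢
  exact (nonempty_retract_of_isCompl h).some.projective

lemma exists_end_fixing_of_inf_eq_bot [Module.Injective R E] {N L : Submodule R E}
    (h : N ⊓ L = ⊥) : ∃ φ : Module.End R E, (∀ x ∈ N, φ x = x) ∧ L ≤ LinearMap.ker φ := by
  have hinj : Function.Injective (L.mkQ ∘ₗ N.subtype) := by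
    rw [← LinearMap.ker_eq_bot, LinearMap.ker_comp, L.ker_mkQ,
      ← Submodule.disjoint_iff_comap_eq_bot]
    exact disjoint_iff.2 h
  obtain ⟨ψ, hψ⟩ := Module.Injective.out _ hinj N.subtype
  exact ⟨ψ ∘ₗ L.mkQ, fun x hx => hψ ⟨x, hx⟩,
    fun x hx => (congrArg ψ ((Submodule.Quotient.mk_eq_zero L).2 hx)).trans (map_zero ψ)⟩

/- The idea is to extend the inclusion of `N`, and zero on `L`, to an endomorphism `φ` of `E`: by
Fitting's lemma the stable image of `φ` is an injective submodule containing `N`. -/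
lemma isEssentialSubmodule_of_minimal_injective [IsArtinian R E] [IsNoetherian R E]
    [Module.Injective R E] {N : Submodule R E}
    (hN : ∀ F : Submodule R E, N ≤ F → Module.Injective R F → F = ⊤) :
    IsEssentialSubmodule N := by
  intro L hL
  obtain ⟨φ, hφN, hφL⟩ := exists_end_fixing_of_inf_eq_bot hL
  obtain ⟨n, hn, hφ⟩ := exists_pos_isCompl_ker_pow_range_pow φ
  have hNφ : N ≤ LinearMap.range (φ ^ n) := fun x hx =>
    ⟨x, by rw [Module.End.pow_apply, Function.iterate_fixed (hφN x hx)]⟩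
  have hLker : L ≤ LinearMap.ker (φ ^ n) := by
    obtain ⟨n, rfl⟩ := Nat.exists_eq_add_of_lt hn
    exact fun x hx => by simp [pow_succ, LinearMap.mem_ker.1 (hφL hx)]
  rw [hN _ hNφ (injective_of_isCompl hφ.symm)] at hφ
  exact le_bot_iff.1 (hLker.trans_eq (eq_bot_of_isCompl_top hφ))

lemma exists_end_congr_of_sup_eq_top [Module.Projective R P] {N L : Submodule R P}
    (h : N ⊔ L = ⊤) : ∃ φ : Module.End R P, (∀ x, φ x - x ∈ N) ∧ LinearMap.range φ ≤ L := by
  have hsurj : Function.Surjective (N.mkQ ∘ₗ L.subtype) := by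
    rw [← LinearMap.range_eq_top, LinearMap.range_comp, L.range_subtype,
      Submodule.map_mkQ_eq_top, h]
  obtain ⟨ψ, hψ⟩ := Module.projective_lifting_property _ N.mkQ hsurj
  refine ⟨L.subtype ∘ₗ ψ, fun x => ?_, ?_⟩
  · exact (Submodule.Quotient.eq N).1 (LinearMap.congr_fun hψ x)
  · exact (LinearMap.range_comp_le_range _ _).trans_eq L.range_subtype

lemma isSuperfluousSubmodule_of_minimal_projective [IsArtinian R P] [IsNoetherian R P]
    [Module.Projective R P] {N : Submodule R P}
    (hN : ∀ F : Submodule R P, N ⊔ F = ⊤ → Module.Projective R F → F = ⊤) :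
    IsSuperfluousSubmodule N := by
  intro L hL
  obtain ⟨φ, hφN, hφL⟩ := exists_end_congr_of_sup_eq_top hL
  obtain ⟨n, hn, hφ⟩ := exists_pos_isCompl_ker_pow_range_pow φ
  have hNφ (n : ℕ) (x : P) : (φ ^ n) x - x ∈ N := by
    induction n with
    | zero => simp
    | succ n ih =>
      rw [pow_succ', ← sub_add_sub_cancel _ ((φ ^ n) x)]
      exact add_mem (hφN _) ih
  have hsup : N ⊔ LinearMap.range (φ ^ n) = ⊤ := eq_top_iff.2 fun x _ =>
    Submodule.mem_sup.2 ⟨_, neg_mem (hNφ n x), _, ⟨x, rfl⟩, by simp⟩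
  have hrange : LinearMap.range (φ ^ n) ≤ L := by
    obtain ⟨n, rfl⟩ := Nat.exists_eq_add_of_lt hn
    rw [zero_add, pow_succ']
    exact (LinearMap.range_comp_le_range _ _).trans hφL
  exact top_le_iff.1 ((hN _ hsup (projective_of_isCompl hφ.symm)).symm.trans_le hrange)

end Fitting

/-- The morphism `j` is a finitely generated injective hull of its source. -/
structure IsFiniteHull {M E : ModuleCat.{u} R} (j : M ⟶ E) : Prop where
  mono : Mono j
  fgInjective : fgInjective R E
  essential : IsEssentialSubmodule (LinearMap.range j.hom)

lemma submodule_eq_top_of_length_le {M : Type*} [AddCommGroup M] [Module R M] [IsArtinian R M]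
    [IsNoetherian R M] {F : Submodule R M} (h : Module.length R M ≤ Module.length R F) : F = ⊤ := by
  rw [Module.length_eq_add_of_exact F.subtype F.mkQ F.subtype_injective F.mkQ_surjective
    (LinearMap.exact_subtype_mkQ F)] at h
  have hF : Module.length R (M ⧸ F) ≤ 0 :=
    ENat.addLECancellable_of_ne_top Module.length_ne_top (h.trans_eq (add_zero _).symm)
  exact Submodule.Quotient.subsingleton_iff.1 (Module.length_eq_zero_iff.1 (le_bot_iff.1 hF))

lemma ker_sup_range_eq_top_iff {L P M : Type*} [AddCommGroup L] [Module R L] [AddCommGroup P]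
    [Module R P] [AddCommGroup M] [Module R M] {g : P →ₗ[R] M} (hg : Function.Surjective g)
    (h : L →ₗ[R] P) :
    LinearMap.ker g ⊔ LinearMap.range h = ⊤ ↔ Function.Surjective (g ∘ₗ h) := by
  rw [sup_comm, ← Submodule.comap_map_eq, ← LinearMap.range_comp, ← LinearMap.range_eq_top,
    ← Submodule.comap_top (f := g)]
  exact (Submodule.comap_injective_of_surjective hg).eq_iff

lemma finite_of_superfluous_ker {P M : Type u} [AddCommGroup P] [Module R P] [AddCommGroup M]
    [Module R M] [Module.Finite R M] {g : P →ₗ[R] M} (hg : Function.Surjective g)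
    (hs : IsSuperfluousSubmodule (LinearMap.ker g)) : Module.Finite R P := by
  obtain ⟨n, p, hp⟩ := Module.Finite.exists_fin' R M
  obtain ⟨h, hh⟩ := Module.projective_lifting_property g p hg
  exact .of_surjective h (LinearMap.range_eq_top.1
    (hs _ ((ker_sup_range_eq_top_iff hg h).2 (hh ▸ hp))))

variable [IsArtinianRing R]

lemma exists_isFiniteHull [EnoughFiniteInjectives R] (M : ModuleCat.{u} R) [Module.Finite R M] :
    ∃ (E : ModuleCat.{u} R) (j : M ⟶ E), IsFiniteHull j := by
  obtain ⟨E₀, j₀, hj₀, hE₀⟩ := EnoughFiniteInjectives.exists_mono M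
  obtain ⟨E, ⟨⟨hEf, hE⟩, j, hj⟩, hmin⟩ := exists_minimalFor_of_wellFoundedLT
    (fun E => fgInjective R E ∧ ∃ j : M ⟶ E, Mono j) (fun E => Module.length R E) ⟨E₀, hE₀, j₀, hj₀⟩
  have := (Module.injective_iff_injective_object R E).2 hE
  refine ⟨E, j, hj, ⟨hEf, hE⟩, isEssentialSubmodule_of_minimal_injective fun F hjF hF => ?_⟩
  let jF : M →ₗ[R] F := j.hom.codRestrict F fun x => hjF ⟨x, rfl⟩
  have hjF : Mono (ModuleCat.ofHom jF) := (ModuleCat.mono_iff_injective _).2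
    ((LinearMap.injective_codRestrict_iff _).2 ((ModuleCat.mono_iff_injective j).1 hj))
  have hFfg : fgInjective R (ModuleCat.of R F) :=
    ⟨inferInstanceAs (Module.Finite R F), (Module.injective_iff_injective_object R F).1 hF⟩
  exact submodule_eq_top_of_length_le
    (hmin ⟨hFfg, _, hjF⟩ (Module.length_le_of_injective F.subtype F.subtype_injective))

lemma exists_projectiveCover (M : ModuleCat.{u} R) [Module.Finite R M] :
    ∃ (P : ModuleCat.{u} R) (π : P ⟶ M), fgProjective R P ∧ Epi π ∧
      IsSuperfluousSubmodule (LinearMap.ker π.hom) := by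
  obtain ⟨_, P₀, _, π₀, h, hP₀, _⟩ := exists_fgProjective_isShortExact M
  obtain ⟨P, ⟨⟨hPf, hP⟩, π, hπ⟩, hmin⟩ := exists_minimalFor_of_wellFoundedLT
    (fun P => fgProjective R P ∧ ∃ π : P ⟶ M, Epi π) (fun P => Module.length R P)
    ⟨P₀, hP₀, π₀, h.epi⟩
  have := (IsProjective.iff_projective P).2 hP
  refine ⟨P, π, ⟨hPf, hP⟩, hπ, isSuperfluousSubmodule_of_minimal_projective fun F hF hFp => ?_⟩
  have hπF : Epi (ModuleCat.ofHom (π.hom ∘ₗ F.subtype)) := by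
    rw [ModuleCat.epi_iff_surjective] at hπ ⊢
    rwa [← F.range_subtype, ker_sup_range_eq_top_iff hπ] at hF
  have hFfg : fgProjective R (ModuleCat.of R F) :=
    ⟨inferInstanceAs (Module.Finite R F), (IsProjective.iff_projective F).1 hFp⟩
  exact submodule_eq_top_of_length_le
    (hmin ⟨hFfg, _, hπF⟩ (Module.length_le_of_injective F.subtype F.subtype_injective))

end HullsAndCovers

section Presentations

variable {A : Type u} [Ring A] {M : ModuleCat.{u} Aᵐᵒᵖ} [Module.Finite Aᵐᵒᵖ M]

lemma nonempty_minimalPresentation [IsArtinianRing Aᵐᵒᵖ] : Nonempty (MinimalPresentation M) := by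
  obtain ⟨P₀, π, hP₀, hπ, hsup₀⟩ := exists_projectiveCover M
  have := hP₀.1
  obtain ⟨P₁, f, hP₁, hf, hsup₁⟩ :=
    exists_projectiveCover (ModuleCat.of Aᵐᵒᵖ (LinearMap.ker π.hom))
  rw [ModuleCat.epi_iff_surjective] at hπ hf
  exact ⟨{
    P₁ := P₁
    P₀ := P₀
    projective₁ := (IsProjective.iff_projective P₁).2 hP₁.2
    projective₀ := (IsProjective.iff_projective P₀).2 hP₀.2
    f := (LinearMap.ker π.hom).subtype ∘ₗ f.hom
    π := π.hom
    surjective := hπ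
    exact := by
      rw [LinearMap.range_comp, LinearMap.range_eq_top.2 hf, Submodule.map_top,
        Submodule.range_subtype]
    superfluous₀ := hsup₀
    superfluous₁ := by rwa [LinearMap.ker_comp_of_ker_eq_bot _ (Submodule.ker_subtype _)] }⟩

namespace MinimalPresentation

variable (p : MinimalPresentation M)

lemma fgProjective₀ : fgProjective Aᵐᵒᵖ p.P₀ :=
  have := p.projective₀
  ⟨finite_of_superfluous_ker p.surjective p.superfluous₀, (IsProjective.iff_projective _).1 this⟩

lemma fgProjective₁ [IsArtinianRing Aᵐᵒᵖ] : fgProjective Aᵐᵒᵖ p.P₁ := by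
  have := p.fgProjective₀.1
  have := p.projective₁
  refine ⟨finite_of_superfluous_ker p.f.surjective_rangeRestrict ?_,
    (IsProjective.iff_projective _).1 this⟩
  rw [LinearMap.ker_rangeRestrict]
  exact p.superfluous₁

end MinimalPresentation

end Presentations

section DominantDimension

variable {R : Type u} [Ring R]

/- The kernel of a morphism to a projective-injective module is torsion as soon as it is minimal
among such kernels. -/
open scoped ZeroObject in
lemma HasDominantDimensionGE.exists_mono {M : ModuleCat.{u} R} [IsArtinian R M]
    (h : HasDominantDimensionGE M 1) :
    ∃ (Q : ModuleCat.{u} R) (f : M ⟶ Q), Mono f ∧ Projective Q ∧ Injective Q := by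
  obtain ⟨⟨Q, f⟩, ⟨hQp, hQi⟩, hmin⟩ := exists_minimalFor_of_wellFoundedLT
    (fun f : Σ Q : ModuleCat.{u} R, M ⟶ Q => Projective f.1 ∧ Injective f.1)
    (fun f => LinearMap.ker f.2.hom) ⟨⟨0, 0⟩, inferInstance, inferInstance⟩
  have hker (Q' : ModuleCat.{u} R) (_ : Projective Q') (_ : Injective Q') (g : M ⟶ Q') :
      LinearMap.ker f.hom ≤ LinearMap.ker g.hom := by
    have hfst := (LinearMap.ker_le_ker_comp (Limits.biprod.lift f g).hom
      (Limits.biprod.fst : Q ⊞ Q' ⟶ Q).hom).trans_eq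
      (congrArg (fun f => LinearMap.ker f.hom) (Limits.biprod.lift_fst f g))
    have hsnd := (LinearMap.ker_le_ker_comp (Limits.biprod.lift f g).hom
      (Limits.biprod.snd : Q ⊞ Q' ⟶ Q').hom).trans_eq
      (congrArg (fun f => LinearMap.ker f.hom) (Limits.biprod.lift_snd f g))
    exact (hmin (j := ⟨Q ⊞ Q', Limits.biprod.lift f g⟩) ⟨inferInstance, inferInstance⟩ hfst).trans
      hsnd
  let ι : ModuleCat.of R (LinearMap.ker f.hom) ⟶ M :=
    ModuleCat.ofHom (LinearMap.ker f.hom).subtype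
  have hι : Mono ι := (ModuleCat.mono_iff_injective _).2 (Submodule.injective_subtype _)
  have hT : IsTorsion (ModuleCat.of R (LinearMap.ker f.hom)) := fun Q' hp hi φ => by
    rw [← Injective.comp_factorThru φ ι]
    ext x
    exact hker Q' hp hi (Injective.factorThru φ ι) x.2
  have hι0 : ι = 0 := extVanish_zero_iff.1 (h _ hT 0 one_pos) ι
  refine ⟨Q, f, (ModuleCat.mono_iff_ker_eq_bot f).2 ?_, hQp, hQi⟩
  rw [← Submodule.range_subtype (LinearMap.ker f.hom)]
  exact LinearMap.range_eq_bot.2 (ModuleCat.hom_ext_iff.1 hι0)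

lemma mono_of_mono_comp_of_isEssentialSubmodule {M E Q : ModuleCat.{u} R} {j : M ⟶ E}
    {g : E ⟶ Q} (hj : IsEssentialSubmodule (LinearMap.range j.hom)) (hjg : Mono (j ≫ g)) :
    Mono g := by
  rw [ModuleCat.mono_iff_injective] at hjg
  refine (ModuleCat.mono_iff_ker_eq_bot g).2 (hj _ ((Submodule.eq_bot_iff _).2 ?_))
  rintro _ ⟨⟨m, rfl⟩, hm⟩
  have : m = 0 := hjg (hm.trans (map_zero (j ≫ g).hom).symm)
  rw [this, map_zero]

lemma IsFiniteHull.fgProjective {M E : ModuleCat.{u} R} [IsArtinian R M] {j : M ⟶ E}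
    (hj : IsFiniteHull j) (h : HasDominantDimensionGE M 1) : fgProjective R E := by
  obtain ⟨Q, f, hf, hQp, hQi⟩ := h.exists_mono
  have := hj.mono
  have := mono_of_mono_comp_of_isEssentialSubmodule (g := Injective.factorThru f j) hj.essential
    (by rwa [Injective.comp_factorThru])
  have := hj.fgInjective.2
  exact ⟨hj.fgInjective.1, Retract.projective ⟨Injective.factorThru f j,
    Injective.factorThru (𝟙 E) (Injective.factorThru f j), Injective.comp_factorThru _ _⟩⟩

lemma IsFiniteHull.hasDominantDimensionGE {M E K : ModuleCat.{u} R} [IsArtinian R M] {j : M ⟶ E}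
    {q : E ⟶ K} (hj : IsFiniteHull j) (hjq : IsShortExact j q) {n : ℕ}
    (h : HasDominantDimensionGE M (n + 1)) : HasDominantDimensionGE K n :=
  have := (hj.fgProjective (h.mono (by lia))).2
  have := hj.fgInjective.2
  .quotient hjq (.of_projective_of_injective n) h

lemma hasDominantDimensionGE_of_le_domdim {M : ModuleCat.{u} R} {n : ℕ} (h : n ≤ domdim M) :
    HasDominantDimensionGE M n := by
  intro T hT i hi
  obtain ⟨_, ⟨k, rfl, I, -, hI⟩, hik⟩ := lt_sSup_iff.1 ((Nat.cast_lt.2 hi).trans_le h)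
  have hIi := (IsProjective.iff_projective _).1 (hI i (Nat.cast_lt.1 hik))
  refine subsingleton_of_forall_eq 0 fun α => ?_
  obtain ⟨f, hf, rfl⟩ := I.extMk_surjective α (i + 1) rfl
  obtain rfl := hT _ hIi (I.injective i) f
  exact I.extMk_zero _ _

variable [IsArtinianRing R] [EnoughFiniteInjectives R] {M : ModuleCat.{u} R}

lemma HasDominantDimensionGE.exists_isSyzygy [hM : Module.Finite R M] {m n : ℕ}
    (h : HasDominantDimensionGE M (m + n)) : ∃ X : ModuleCat.{u} R, Module.Finite R X ∧
      HasDominantDimensionGE X m ∧ IsSyzygy (fgProjective R ⊓ fgInjective R) n X M := by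
  induction n generalizing M with
  | zero => exact ⟨M, hM, h, .zero M⟩
  | succ n ih =>
    obtain ⟨E, j, hj⟩ := exists_isFiniteHull M
    have := hj.mono
    have := hj.fgInjective.1
    have hE := hj.fgProjective (h.mono (by lia))
    obtain ⟨X, hX, hXm, hXM⟩ := ih
      (hM := inferInstanceAs (Module.Finite R (E ⧸ LinearMap.range j.hom)))
      (hj.hasDominantDimensionGE (isShortExact_mkQ j) h)
    exact ⟨X, hX, hXm, .succ (isShortExact_mkQ j) ⟨hE, hj.fgInjective⟩ hXM⟩

lemma exists_minimal_cosyzygies (M : ModuleCat.{u} R) [hM : Module.Finite R M] :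
    ∃ (N E : ℕ → ModuleCat.{u} R) (j : ∀ i, N i ⟶ E i) (q : ∀ i, E i ⟶ N (i + 1)), N 0 = M ∧
      ∀ i, Module.Finite R (N i) ∧ IsFiniteHull (j i) ∧ IsShortExact (j i) (q i) := by
  let FG := {X : ModuleCat.{u} R // Module.Finite R X}
  choose E j hj using fun X : FG => have := X.2; exists_isFiniteHull X.1
  let next (X : FG) : FG := ⟨ModuleCat.of R (E X ⧸ LinearMap.range (j X).hom),
    have := (hj X).fgInjective.1; inferInstanceAs (Module.Finite R (E X ⧸ _))⟩
  let N (i : ℕ) : FG := Nat.rec ⟨M, hM⟩ (fun _ => next) i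
  exact ⟨fun i => (N i).1, fun i => E (N i), fun i => j (N i), fun i => ModuleCat.ofHom
    (Submodule.mkQ _), rfl, fun i => ⟨(N i).2, hj _, have := (hj (N i)).mono; isShortExact_mkQ _⟩⟩

lemma HasDominantDimensionGE.le_domdim [hM : Module.Finite R M] {n : ℕ}
    (h : HasDominantDimensionGE M n) : n ≤ domdim M := by
  obtain ⟨N, E, j, q, rfl, H⟩ := exists_minimal_cosyzygies M
  have hfin (i : ℕ) : IsArtinian R (N i) := have := (H i).1; inferInstance
  have hN (i : ℕ) : ∀ m, HasDominantDimensionGE (N 0) (m + i) → HasDominantDimensionGE (N i) m := by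
    induction i with
    | zero => exact fun _ => id
    | succ i ih => exact fun m hm =>
        (H i).2.1.hasDominantDimensionGE (H i).2.2 (ih (m + 1) (by rwa [add_right_comm]))
  have hjq (i : ℕ) := (H i).2.2
  have hE (i : ℕ) : Injective (E i) := (H i).2.1.fgInjective.2
  refine le_sSup ⟨n, rfl, splicedResolution hjq, fun i => ?_, fun i hi => ?_⟩
  · suffices LinearMap.ker ((splicedComplex hjq).d i (i + 1)).hom = LinearMap.range (j i).hom from
      this ▸ (H i).2.1.essential
    have hker : LinearMap.ker (q i ≫ j (i + 1)).hom = LinearMap.range (j i).hom :=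
      (LinearMap.ker_comp_of_ker_eq_bot _
        ((ModuleCat.mono_iff_ker_eq_bot _).1 (hjq (i + 1)).mono)).trans
        (LinearMap.exact_iff.1 (isShortExact_iff.1 (hjq i)).2.1)
    exact (congrArg (fun f => LinearMap.ker f.hom) (splicedComplex_d hjq i)).trans hker
  · exact (IsProjective.iff_projective _).2
      ((H i).2.1.fgProjective (hN i 1 (h.mono (by lia)))).2

end DominantDimension

section InjectiveDimension

variable {R : Type u} [Ring R] {Y : ModuleCat.{u} R} {n : ℕ}

lemma injective_of_forall_finite_extVanish_one
    (h : ∀ X : ModuleCat.{u} R, Module.Finite R X → ExtVanish X Y 1) : Injective Y := by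
  refine (Module.injective_iff_injective_object R Y).1 (Module.Baer.injective fun I g => ?_)
  have hI : IsShortExact (ModuleCat.ofHom I.subtype) (ModuleCat.ofHom I.mkQ) :=
    isShortExact_iff.2 ⟨I.subtype_injective, LinearMap.exact_subtype_mkQ I, I.mkQ_surjective⟩
  obtain ⟨ψ, hψ⟩ := hI.exists_extension (h _ (inferInstanceAs (Module.Finite R (R ⧸ I))))
    (ModuleCat.ofHom g)
  exact ⟨ψ.hom, fun x hx => congrArg (· ⟨x, hx⟩) hψ⟩

lemma hasInjectiveDimensionLE_of_forall_finite
    (h : ∀ X : ModuleCat.{u} R, Module.Finite R X → ExtVanish X Y (n + 1)) :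
    HasInjectiveDimensionLE Y n := by
  induction n generalizing Y with
  | zero =>
    have := injective_of_forall_finite_extVanish_one h
    rwa [HasInjectiveDimensionLE, ← injective_iff_hasInjectiveDimensionLT_one]
  | succ n ih =>
    have hY := isShortExact_mkQ (Injective.ι Y)
    refine (hY.choose_spec.hasInjectiveDimensionLT_X₃_iff n (Injective.injective_under Y)).1
      (ih fun X hX => ?_)
    exact hY.extVanish_covariant₃ (extVanish_of_injective (by lia)) (h X hX)

variable [EnoughFiniteInjectives R] [Module.Finite R Y]

lemma HasDominantDimensionGE.of_hasInjectiveDimensionLE [IsArtinianRing R]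
    (h : HasDominantDimensionGE Y (n + 1)) (hY : HasInjectiveDimensionLE Y n) (m : ℕ) :
    HasDominantDimensionGE Y m := by
  rw [add_comm] at h
  obtain ⟨C, hC, hC₁, hCY⟩ := h.exists_isSyzygy
  have hCi : Injective C := injective_of_forall_finite_extVanish_one fun X _ =>
    (hCY.extVanish_right_iff (fun E hE _ => have := hE.2.2; extVanish_of_injective) le_rfl).2
      (extVanish_of_hasInjectiveDimensionLT hY (by lia))
  obtain ⟨Q, f, _, hQ, -⟩ := hC₁.exists_mono
  have hCp : Projective C := Retract.projective
    ⟨f, Injective.factorThru (𝟙 C) f, Injective.comp_factorThru _ _⟩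
  refine (hCY.hasDominantDimensionGE (fun E hE => ?_) (.of_projective_of_injective m)).mono
    (Nat.le_add_right m n)
  have := hE.1.2
  have := hE.2.2
  exact .of_projective_of_injective _

lemma hasInjectiveDimensionLE_of_forall_fgInjective (hY : HasInjectiveDimensionLE Y (n + 1))
    (h : ∀ J, fgInjective R J → ExtVanish J Y (n + 1)) : HasInjectiveDimensionLE Y n := by
  obtain ⟨C, hC, hCY⟩ := exists_isSyzygy_fgInjective n Y
  have hCY (X : ModuleCat.{u} R) {i : ℕ} : 1 ≤ i → (ExtVanish X C i ↔ ExtVanish X Y (i + n)) :=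
    hCY.extVanish_right_iff fun E hE _ => have := hE.2; extVanish_of_injective
  obtain ⟨E, j, _, hEf, hE⟩ := EnoughFiniteInjectives.exists_mono C
  have hj := isShortExact_mkQ j
  have hquot : fgInjective R (ModuleCat.of R (E ⧸ LinearMap.range j.hom)) := by
    refine ⟨inferInstanceAs (Module.Finite R (E ⧸ _)),
      injective_of_forall_finite_extVanish_one fun X _ => ?_⟩
    exact hj.extVanish_covariant₃ (extVanish_of_injective le_rfl) ((hCY X (by lia)).2
      (extVanish_of_hasInjectiveDimensionLT hY (by lia)))
  obtain ⟨r⟩ := hj.nonempty_retract ((hCY _ le_rfl).2 (add_comm n 1 ▸ h _ hquot))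
  have hCi : Injective C := r.injective
  exact hasInjectiveDimensionLE_of_forall_finite fun X _ =>
    add_comm 1 n ▸ (hCY X le_rfl).1 (extVanish_of_injective le_rfl)

end InjectiveDimension

section Transpose

open MulOpposite

variable {A : Type u} [Ring A]

/-- The identification of the two right module structures: `Aᵐᵒᵖ` over itself and `A_A`. -/
def unopLinearEquiv (A : Type u) [Ring A] : Aᵐᵒᵖ ≃ₗ[Aᵐᵒᵖ] A where
  toFun := unop
  invFun := op
  left_inv _ := rfl
  right_inv _ := rfl
  map_add' _ _ := rfl
  map_smul' _ _ := rfl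

lemma fgProjective_rightRegular_pi (n : ℕ) :
    fgProjective Aᵐᵒᵖ (ModuleCat.of Aᵐᵒᵖ (Fin n → A)) := by
  have e := LinearEquiv.piCongrRight fun _ : Fin n => unopLinearEquiv A
  exact ⟨Module.Finite.equiv e,
    (IsProjective.iff_projective _).1 (Module.Projective.of_equiv e)⟩

/-- The dual `M* = Hom_A(M, A)` of a right `A`-module, as a left `A`-module. -/
abbrev regularDual (M : ModuleCat.{u} Aᵐᵒᵖ) : ModuleCat.{u} A := ModuleCat.of A (M →ₗ[Aᵐᵒᵖ] A)

variable {P P₀ P₁ P₂ M : ModuleCat.{u} Aᵐᵒᵖ}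

lemma fgProjective.exists_dualBasis (hP : fgProjective Aᵐᵒᵖ P) :
    ∃ (n : ℕ) (p : Fin n → P) (s : Fin n → regularDual P), ∀ x, ∑ i, op (s i x) • p i = x := by
  obtain ⟨n, ⟨r⟩⟩ := hP.exists_retract
  refine ⟨n, fun i => r.r.hom (Pi.single i 1),
    fun i => (unopLinearEquiv A).toLinearMap ∘ₗ LinearMap.proj i ∘ₗ r.i.hom, fun x => ?_⟩
  have h : r.r.hom (r.i.hom x) = x := congrArg (· x) r.retract
  conv_rhs => rw [← h, ← (Pi.basisFun Aᵐᵒᵖ (Fin n)).sum_repr (r.i.hom x), map_sum]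
  simp [unopLinearEquiv]

lemma sum_apply_smul_of_dualBasis {n : ℕ} {p : Fin n → P} {s : Fin n → regularDual P}
    (h : ∀ x, ∑ i, op (s i x) • p i = x) (ψ : regularDual P) : ∑ i, ψ (p i) • s i = ψ := by
  ext x
  conv_rhs => rw [← h x, map_sum]
  simp

lemma fgProjective_regularDual (hP : fgProjective Aᵐᵒᵖ P) : fgProjective A (regularDual P) := by
  obtain ⟨n, p, s, h⟩ := hP.exists_dualBasis
  have hs (ψ : regularDual P) : Fintype.linearCombination A s (fun i => ψ (p i)) = ψ :=
    sum_apply_smul_of_dualBasis h ψ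
  let coords : regularDual P →ₗ[A] (Fin n → A) :=
    { toFun := fun ψ i => ψ (p i)
      map_add' := fun _ _ => rfl
      map_smul' := fun _ _ => rfl }
  exact ⟨Module.Finite.of_surjective _ fun ψ => ⟨_, hs ψ⟩, (IsProjective.iff_projective _).1
    (Module.Projective.of_split coords (Fintype.linearCombination A s) (LinearMap.ext hs))⟩

lemma fgProjective.exists_eq_eval (hP : fgProjective Aᵐᵒᵖ P) (θ : regularDual P →ₗ[A] A) :
    ∃ y : P, ∀ ψ : regularDual P, θ ψ = ψ y := by
  obtain ⟨n, p, s, h⟩ := hP.exists_dualBasis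
  refine ⟨∑ i, op (θ (s i)) • p i, fun ψ => ?_⟩
  conv_lhs => rw [← sum_apply_smul_of_dualBasis h ψ]
  simp

lemma fgProjective.eq_of_forall_dual_eq (hP : fgProjective Aᵐᵒᵖ P) {x y : P}
    (hxy : ∀ ψ : regularDual P, ψ x = ψ y) : x = y := by
  obtain ⟨n, p, s, h⟩ := hP.exists_dualBasis
  rw [← h x, ← h y]
  simp only [hxy]

/-- The dual `f* : P₀* ⟶ P₁*` of `f : P₁ ⟶ P₀`. -/
noncomputable def dualMap (f : P₁ ⟶ P₀) : regularDual P₀ ⟶ regularDual P₁ :=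
  ModuleCat.ofHom (LinearMap.lcomp A A f.hom)

/-- The cokernel of `f*`. For the first map of a projective presentation of `M` it is a transpose of
`M`, and for a minimal one it is `MinimalPresentation.transpose`. -/
noncomputable abbrev Tr (f : P₁ ⟶ P₀) : ModuleCat.{u} A :=
  ModuleCat.of A (regularDual P₁ ⧸ LinearMap.range (dualMap f).hom)

lemma isShortExact_Tr {f : P₁ ⟶ P₀} {f₂ : P₂ ⟶ P₁} (h : Function.Exact (dualMap f) (dualMap f₂)) :
    IsShortExact (X := Tr f) (Z := Tr f₂) (ModuleCat.ofHom ((LinearMap.range (dualMap f).hom).liftQ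
      (dualMap f₂).hom h.linearMap_ker_eq.ge)) (ModuleCat.ofHom (Submodule.mkQ _)) := by
  refine isShortExact_iff.2 ⟨LinearMap.ker_eq_bot.1
    (Submodule.ker_liftQ_eq_bot _ _ _ h.linearMap_ker_eq.le), LinearMap.exact_iff.2 ?_,
    Submodule.mkQ_surjective _⟩
  exact (Submodule.ker_mkQ _).trans (Submodule.range_liftQ _ _ _).symm

/-- A presentation `P₁ ⟶ P₀ ⟶ M ⟶ 0` by finitely generated projective modules. -/
structure IsPresentation (f : P₁ ⟶ P₀) (π : P₀ ⟶ M) : Prop where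
  fgProjective₁ : fgProjective Aᵐᵒᵖ P₁
  fgProjective₀ : fgProjective Aᵐᵒᵖ P₀
  exact : Function.Exact f π
  surjective : Function.Surjective π

/-- `Extⁱ(Tr f, A) = 0` for all `i ≥ 1`. -/
def TrVanish (f : P₁ ⟶ P₀) : Prop := ∀ i, 1 ≤ i → ExtVanish (Tr f) (leftRegular A) i

lemma exact_dualMap_iff {f : P₁ ⟶ P₀} {f₂ : P₂ ⟶ P₁} :
    Function.Exact (dualMap f) (dualMap f₂) ↔
      ∀ ψ : P₁ ⟶ rightRegular A, f₂ ≫ ψ = 0 ↔ ∃ χ : P₀ ⟶ rightRegular A, f ≫ χ = ψ := by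
  have hker (ψ : P₁ ⟶ rightRegular A) : f₂ ≫ ψ = 0 ↔ dualMap f₂ ψ.hom = 0 :=
    ModuleCat.hom_ext_iff
  have hrange (ψ : P₁ ⟶ rightRegular A) :
      (∃ χ : P₀ ⟶ rightRegular A, f ≫ χ = ψ) ↔ ψ.hom ∈ Set.range (dualMap f) :=
    ⟨fun ⟨χ, hχ⟩ => ⟨χ.hom, congrArg ModuleCat.Hom.hom hχ⟩,
      fun ⟨χ, hχ⟩ => ⟨ModuleCat.ofHom χ, ModuleCat.hom_ext hχ⟩⟩
  exact ⟨fun h ψ => (hker ψ).trans ((h ψ.hom).trans (hrange ψ).symm), fun h ψ =>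
    (hker (ModuleCat.ofHom ψ)).symm.trans ((h (ModuleCat.ofHom ψ)).trans (hrange _))⟩

lemma exact_dualMap_of_isShortExact {K : ModuleCat.{u} Aᵐᵒᵖ} {k : K ⟶ P₀} {π : P₀ ⟶ M}
    {e : P₁ ⟶ K} {f₂ : P₂ ⟶ P₁} (hk : IsShortExact k π) (hf₂ : Function.Exact f₂ e)
    (he : Function.Surjective e) (hM : ExtVanish M (rightRegular A) 1) :
    Function.Exact (dualMap (e ≫ k)) (dualMap f₂) := by
  refine exact_dualMap_iff.2 fun ψ => ⟨fun hψ => ?_, ?_⟩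
  · obtain ⟨χ, rfl⟩ := exists_desc_of_exact hf₂ he ψ hψ
    obtain ⟨l, rfl⟩ := hk.exists_extension hM χ
    exact ⟨l, Category.assoc e k l⟩
  · rintro ⟨l, rfl⟩
    have : f₂ ≫ e = 0 := ModuleCat.hom_ext hf₂.linearMap_comp_eq_zero
    rw [Category.assoc, reassoc_of% this, Limits.zero_comp]

lemma IsPresentation.exists_syzygy [IsNoetherianRing Aᵐᵒᵖ] {f : P₁ ⟶ P₀} {π : P₀ ⟶ M}
    (h : IsPresentation f π) : ∃ (K P₂ : ModuleCat.{u} Aᵐᵒᵖ) (k : K ⟶ P₀) (e : P₁ ⟶ K)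
      (f₂ : P₂ ⟶ P₁), IsShortExact k π ∧ e ≫ k = f ∧ IsPresentation f₂ e := by
  have := h.fgProjective₁.1
  have : Epi π := (ModuleCat.epi_iff_surjective π).2 h.surjective
  let e : P₁ ⟶ ModuleCat.of Aᵐᵒᵖ (LinearMap.ker π.hom) := ModuleCat.ofHom
    (f.hom.codRestrict _ h.exact.apply_apply_eq_zero)
  have he : Function.Surjective e := fun ⟨y, hy⟩ => by
    obtain ⟨x, rfl⟩ := (h.exact y).1 hy
    exact ⟨x, rfl⟩
  have : Module.Finite Aᵐᵒᵖ (ModuleCat.of Aᵐᵒᵖ (LinearMap.ker e.hom)) :=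
    inferInstanceAs (Module.Finite Aᵐᵒᵖ (LinearMap.ker e.hom))
  obtain ⟨_, P₂, _, q, hq, hP₂, -⟩ :=
    exists_fgProjective_isShortExact (ModuleCat.of Aᵐᵒᵖ (LinearMap.ker e.hom))
  refine ⟨_, P₂, _, e, q ≫ ModuleCat.ofHom (LinearMap.ker e.hom).subtype, isShortExact_subtype π,
    rfl, hP₂, h.fgProjective₁, ?_, he⟩
  exact (Function.Surjective.comp_exact_iff_exact (isShortExact_iff.1 hq).2.2).2
    (LinearMap.exact_subtype_ker_map e.hom)

lemma IsPresentation.exists_isSyzygy_Tr [IsNoetherianRing Aᵐᵒᵖ] {f : P₁ ⟶ P₀} {π : P₀ ⟶ M}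
    (h : IsPresentation f π) (hM : ∀ i, 1 ≤ i → ExtVanish M (rightRegular A) i) (n : ℕ) :
    ∃ T, IsSyzygy (fgProjective A) n T (Tr f) := by
  let 𝒳 : ObjectProperty (ModuleCat.{u} A) := fun T =>
    ∃ (P₁ P₀ M : ModuleCat.{u} Aᵐᵒᵖ) (f : P₁ ⟶ P₀) (π : P₀ ⟶ M),
      T = Tr f ∧ IsPresentation f π ∧ ∀ i, 1 ≤ i → ExtVanish M (rightRegular A) i
  suffices H : ∀ Y, 𝒳 Y → ∃ (P K : ModuleCat.{u} A) (j : Y ⟶ P) (q : P ⟶ K),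
      IsShortExact j q ∧ fgProjective A P ∧ 𝒳 K by
    obtain ⟨T, -, hT⟩ := exists_isSyzygy_of_forall_cosyzygy H n ⟨_, _, _, f, π, rfl, h, hM⟩
    exact ⟨T, hT⟩
  rintro _ ⟨P₁, P₀, M, f, π, rfl, h, hM⟩
  obtain ⟨K, P₂, k, e, f₂, hk, rfl, hf₂⟩ := h.exists_syzygy
  refine ⟨_, _, _, _, isShortExact_Tr
    (exact_dualMap_of_isShortExact hk hf₂.exact hf₂.surjective (hM 1 le_rfl)),
    fgProjective_regularDual hf₂.fgProjective₁, _, _, K, f₂, e, rfl, hf₂, fun i hi => ?_⟩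
  have := h.fgProjective₀.2
  exact hk.extVanish_contravariant₁ (extVanish_of_projective hi) (hM (i + 1) (by lia))

lemma exists_left_approximation [IsNoetherianRing A] (f : P₁ ⟶ P₀) (hP₀ : fgProjective Aᵐᵒᵖ P₀) :
    ∃ (F : ModuleCat.{u} Aᵐᵒᵖ) (φ : P₀ ⟶ F), fgProjective Aᵐᵒᵖ F ∧
      Function.Exact (dualMap φ) (dualMap f) := by
  have : Module.Finite A (regularDual P₀) := (fgProjective_regularDual hP₀).1
  obtain ⟨n, φ, hφ⟩ := Submodule.fg_iff_exists_fin_generating_family.1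
    (IsNoetherian.noetherian (LinearMap.ker (dualMap f).hom))
  refine ⟨_, ModuleCat.ofHom (LinearMap.pi φ), fgProjective_rightRegular_pi n,
    fun ψ => ⟨fun hψ => ?_, ?_⟩⟩
  · suffices LinearMap.ker (dualMap f).hom ≤
      LinearMap.range (dualMap (ModuleCat.ofHom (LinearMap.pi φ))).hom from this hψ
    rw [← hφ, Submodule.span_le]
    rintro _ ⟨i, rfl⟩
    exact ⟨LinearMap.proj i, LinearMap.proj_pi _ _⟩
  · rintro ⟨l, rfl⟩
    have (i : Fin n) : φ i ∘ₗ f.hom = 0 :=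
      (hφ ▸ Submodule.subset_span ⟨i, rfl⟩ : φ i ∈ LinearMap.ker (dualMap f).hom)
    have hpi : LinearMap.pi φ ∘ₗ f.hom = 0 := by
      ext x i
      exact LinearMap.congr_fun (this i) x
    change (l ∘ₗ LinearMap.pi φ) ∘ₗ f.hom = 0
    rw [LinearMap.comp_assoc, hpi, LinearMap.comp_zero]

lemma exact_of_exact_dualMap {f : P₁ ⟶ P₀} {φ : P₀ ⟶ P₂} (hP₁ : fgProjective Aᵐᵒᵖ P₁)
    (hP₀ : fgProjective Aᵐᵒᵖ P₀) (hP₂ : fgProjective Aᵐᵒᵖ P₂)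
    (h : Function.Exact (dualMap φ) (dualMap f)) (hf : ExtVanish (Tr f) (leftRegular A) 1) :
    Function.Exact f φ := by
  refine fun x => ⟨fun hx => ?_, ?_⟩
  · let evalAt : regularDual P₀ →ₗ[A] A :=
      { toFun := fun ψ => ψ x
        map_add' := fun _ _ => rfl
        map_smul' := fun _ _ => rfl }
    have hker : LinearMap.range (dualMap φ).hom ≤ LinearMap.ker evalAt := by
      rintro _ ⟨l, rfl⟩
      exact (congrArg l hx).trans (map_zero l)
    obtain ⟨θ, hθ⟩ := (isShortExact_Tr h).exists_extension hf
      (ModuleCat.ofHom (Submodule.liftQ _ evalAt hker))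
    obtain ⟨y, hy⟩ := hP₁.exists_eq_eval θ.hom
    refine ⟨y, hP₀.eq_of_forall_dual_eq fun ψ => ?_⟩
    exact (hy (ψ ∘ₗ f.hom)).symm.trans (congrArg (· (Submodule.Quotient.mk ψ)) hθ)
  · rintro ⟨x, rfl⟩
    refine hP₂.eq_of_forall_dual_eq fun ψ => ?_
    have := LinearMap.congr_fun (h.apply_apply_eq_zero ψ) x
    exact this.trans (map_zero ψ).symm

lemma TrVanish.of_exact_dualMap {f : P₁ ⟶ P₀} {φ : P₀ ⟶ P₂} (hP₁ : fgProjective Aᵐᵒᵖ P₁)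
    (h : Function.Exact (dualMap φ) (dualMap f)) (hf : TrVanish f) : TrVanish φ := fun i hi =>
  have := (fgProjective_regularDual hP₁).2
  (isShortExact_Tr h).extVanish_contravariant₁ (extVanish_of_projective hi) (hf (i + 1) (by lia))

/-- Gorenstein projectivity, with an arbitrary finitely generated projective presentation in the
place of the minimal one of `Gp`. -/
structure IsGProj (M : ModuleCat.{u} Aᵐᵒᵖ) : Prop where
  extVanish : ∀ i, 1 ≤ i → ExtVanish M (rightRegular A) i
  exists_presentation : ∃ (P₁ P₀ : ModuleCat.{u} Aᵐᵒᵖ) (f : P₁ ⟶ P₀) (π : P₀ ⟶ M),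
    IsPresentation f π ∧ TrVanish f

lemma isGProj_of_mem_Gp [IsArtinianRing Aᵐᵒᵖ] (hM : Gp A M) : IsGProj M := by
  obtain ⟨_, hM, p, hp⟩ := hM
  exact ⟨hM, p.P₁, p.P₀, ModuleCat.ofHom p.f, ModuleCat.ofHom p.π,
    ⟨p.fgProjective₁, p.fgProjective₀, LinearMap.exact_iff.2 p.exact.symm, p.surjective⟩, hp⟩

lemma IsGProj.exists_cosyzygy [IsNoetherianRing A] (hM : IsGProj M) :
    ∃ (F C : ModuleCat.{u} Aᵐᵒᵖ) (j : M ⟶ F) (q : F ⟶ C), IsShortExact j q ∧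
      fgProjective Aᵐᵒᵖ F ∧ IsGProj C := by
  obtain ⟨P₁, P₀, f, π, hfπ, hf⟩ := hM.exists_presentation
  obtain ⟨F, φ, hF, hdual⟩ := exists_left_approximation f hfπ.fgProjective₀
  have hfφ := exact_of_exact_dualMap hfπ.fgProjective₁ hfπ.fgProjective₀ hF hdual (hf 1 le_rfl)
  obtain ⟨j, rfl⟩ := exists_desc_of_exact hfπ.exact hfπ.surjective φ
    (ModuleCat.hom_ext hfφ.linearMap_comp_eq_zero)
  have : Mono j := by
    refine (ModuleCat.mono_iff_injective j).2 ((injective_iff_map_eq_zero j.hom).2 fun m hm => ?_)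
    obtain ⟨x, rfl⟩ := hfπ.surjective m
    exact (hfπ.exact x).2 ((hfφ x).1 hm)
  have hj := isShortExact_mkQ j
  have := hF.2
  refine ⟨F, _, j, _, hj, hF, ?_, P₀, F, π ≫ j, _, ⟨hfπ.fgProjective₀, hF, ?_,
    (isShortExact_iff.1 hj).2.2⟩, hf.of_exact_dualMap hfπ.fgProjective₁ hdual⟩
  · rintro (_ | _ | i) hi
    · lia
    · refine hj.extVanish_one_of_exists_extension (extVanish_of_projective le_rfl) fun h => ?_
      have hfπ₀ : f ≫ π = 0 := ModuleCat.hom_ext hfπ.exact.linearMap_comp_eq_zero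
      obtain ⟨l, hl⟩ := (exact_dualMap_iff.1 hdual (π ≫ h)).1
        (by rw [reassoc_of% hfπ₀, Limits.zero_comp])
      have : Epi π := (ModuleCat.epi_iff_surjective π).2 hfπ.surjective
      exact ⟨l, by rwa [Category.assoc, cancel_epi] at hl⟩
    · exact hj.extVanish_contravariant₃ (hM.extVanish (i + 1) (by lia))
        (extVanish_of_projective (by lia))
  · exact (Function.Surjective.comp_exact_iff_exact hfπ.surjective).2 (isShortExact_iff.1 hj).2.1

lemma IsGProj.exists_isSyzygy [IsNoetherianRing A] (hM : IsGProj M) (n : ℕ) :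
    ∃ C : ModuleCat.{u} Aᵐᵒᵖ, IsGProj C ∧ IsSyzygy (fgProjective Aᵐᵒᵖ) n C M :=
  exists_isSyzygy_of_forall_cosyzygy (𝒳 := IsGProj) (fun _ hM => hM.exists_cosyzygy) n hM

end Transpose

section Duality

open MulOpposite
open scoped ModuleCat

variable {K R S : Type u} [Field K] [Ring R] [Algebra K R] [Ring S] [Algebra K S]

/-- The dual `Hom_K(N, K)` of a left `R`-module `N`, as a left module over an algebra `S` that is
identified with `Rᵐᵒᵖ`. Keeping `S` apart from `Rᵐᵒᵖ` lets left and right modules play symmetric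
roles, see `opSymm`. -/
noncomputable def kDual (τ : S ≃ₐ[K] Rᵐᵒᵖ) (N : ModuleCat.{u} R) : ModuleCat.{u} S :=
  letI : Module S (N →ₗ[K] K) :=
    { smul := fun s f => f ∘ₗ Algebra.lsmul K K N (τ s).unop
      one_smul := fun f => LinearMap.ext fun n => congrArg f (by
        rw [map_one, unop_one, map_one, Module.End.one_apply])
      mul_smul := fun s t f => LinearMap.ext fun n => congrArg f (by
        rw [map_mul, unop_mul, map_mul, Module.End.mul_apply])
      smul_zero := fun _ => rfl
      smul_add := fun _ _ _ => rfl
      add_smul := fun s t f => LinearMap.ext fun n =>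
        (congrArg f (by rw [map_add, MulOpposite.unop_add, map_add, LinearMap.add_apply])).trans
          (map_add f _ _)
      zero_smul := fun f => LinearMap.ext fun n =>
        (congrArg f (by rw [map_zero, unop_zero, map_zero, LinearMap.zero_apply])).trans
          (map_zero f) }
  ModuleCat.of S (N →ₗ[K] K)

/-- An identification of `S` with `Rᵐᵒᵖ` seen as an identification of `R` with `Sᵐᵒᵖ`. This is an
involution by definition, so that a statement about `τ` also applies to `opSymm τ`. -/
abbrev opSymm (τ : S ≃ₐ[K] Rᵐᵒᵖ) : R ≃ₐ[K] Sᵐᵒᵖ := (AlgEquiv.opComm τ).symm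

variable {τ : S ≃ₐ[K] Rᵐᵒᵖ} {N N' N'' : ModuleCat.{u} R} {X : ModuleCat.{u} S}

lemma unop_opSymm_unop (s : S) : (opSymm τ (τ s).unop).unop = s := τ.symm_apply_apply s

namespace kDual

noncomputable instance : FunLike (kDual τ N) N K := inferInstanceAs (FunLike (N →ₗ[K] K) N K)

instance : LinearMapClass (kDual τ N) K N K :=
  inferInstanceAs (LinearMapClass (N →ₗ[K] K) K N K)

lemma ext {f g : kDual τ N} (h : ∀ n, f n = g n) : f = g := LinearMap.ext h

lemma add_apply (f g : kDual τ N) (n : N) : (f + g) n = f n + g n := rfl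

lemma smul_apply (s : S) (f : kDual τ N) (n : N) : (s • f) n = f ((τ s).unop • n) := rfl

lemma base_smul_apply (k : K) (f : kDual τ N) (n : N) : (k • f) n = k • f n := by
  rw [← algebraMap_smul S k f, smul_apply, AlgEquiv.commutes, MulOpposite.algebraMap_apply,
    unop_op, algebraMap_smul, map_smul]

/-- The dual of a linear map. -/
noncomputable def map (τ : S ≃ₐ[K] Rᵐᵒᵖ) (g : N ⟶ N') : kDual τ N' ⟶ kDual τ N :=
  ModuleCat.ofHom (X := kDual τ N') (Y := kDual τ N)
    { toFun := fun f => (f : N' →ₗ[K] K) ∘ₗ g.hom.restrictScalars K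
      map_add' := fun _ _ => rfl
      map_smul' := fun s f => ext fun n => congrArg f (g.hom.map_smul (τ s).unop n).symm }

/-- The `S`-linear map `X ⟶ N*` with the same underlying bilinear map `N × X → K` as a given
`R`-linear map `N ⟶ X*`. -/
noncomputable def flip (φ : N ⟶ kDual (opSymm τ) X) : X ⟶ kDual τ N :=
  ModuleCat.ofHom (Y := kDual τ N)
    { toFun := fun x =>
        { toFun := fun n => φ n x
          map_add' := fun m n => by rw [map_add, add_apply]
          map_smul' := fun k n => by
            rw [← algebraMap_smul R k n, map_smul, algebraMap_smul, base_smul_apply,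
              RingHom.id_apply] }
      map_add' := fun x y => ext fun n => map_add (φ n) x y
      map_smul' := fun s x => ext fun n => by
        change φ n (s • x) = φ ((τ s).unop • n) x
        rw [map_smul φ.hom, smul_apply, unop_opSymm_unop] }

lemma map_surjective {g : N ⟶ N'} (hg : Function.Injective g) :
    Function.Surjective (map τ g) :=
  LinearMap.dualMap_surjective_iff (f := g.hom.restrictScalars K).2 hg

lemma isShortExact_map {f : N' ⟶ N} {g : N ⟶ N''} (h : IsShortExact f g) :
    IsShortExact (map τ g) (map τ f) := by
  obtain ⟨hf, hfg, hg⟩ := isShortExact_iff.1 h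
  have hfg' : Function.Exact (f.hom.restrictScalars K) (g.hom.restrictScalars K) := hfg
  refine isShortExact_iff.2 ⟨LinearMap.dualMap_injective_iff (f := g.hom.restrictScalars K).2 hg,
    ?_, map_surjective hf⟩
  have : Function.Exact (g.hom.restrictScalars K).dualMap (f.hom.restrictScalars K).dualMap := by
    rw [LinearMap.exact_iff, LinearMap.ker_dualMap_eq_dualAnnihilator_range,
      LinearMap.range_dualMap_eq_dualAnnihilator_ker, hfg'.linearMap_ker_eq]
  exact this

instance injective [Projective N] : Injective (kDual τ N) where
  factors {X Y} g f _ := by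
    have : Epi (map (opSymm τ) f) := (ModuleCat.epi_iff_surjective _).2
      (map_surjective ((ModuleCat.mono_iff_injective f).1 inferInstance))
    obtain ⟨l, hl⟩ := Projective.factors (flip (τ := opSymm τ) g) (map (opSymm τ) f)
    refine ⟨flip l, ModuleCat.hom_ext (LinearMap.ext fun x => ext fun n => ?_)⟩
    exact DFunLike.congr_fun (congrArg (· n) hl) x

/-- The dual of `N` is the dual vector space of `N`. -/
noncomputable def toDual (τ : S ≃ₐ[K] Rᵐᵒᵖ) (N : ModuleCat.{u} R) :
    kDual τ N ≃ₗ[K] Module.Dual K N where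
  toFun f := f
  invFun f := f
  map_add' _ _ := rfl
  map_smul' k f := LinearMap.ext (base_smul_apply k f)
  left_inv _ := rfl
  right_inv _ := rfl

variable [FiniteDimensional K R] [Module.Finite R N]

variable (τ N) in
lemma finite : Module.Finite S (kDual τ N) :=
  have : Module.Finite K N := .trans R N
  have : Module.Finite K (kDual τ N) := .equiv (toDual τ N).symm
  .of_restrictScalars_finite K S _

/-- The evaluation map from a module to its bidual. -/
noncomputable def eval (τ : S ≃ₐ[K] Rᵐᵒᵖ) (N : ModuleCat.{u} R) :
    N ⟶ kDual (opSymm τ) (kDual τ N) :=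
  flip (τ := opSymm τ) (𝟙 (kDual τ N))

variable (τ N) in
instance isIso_eval : IsIso (eval τ N) := by
  have : Module.Finite K N := .trans R N
  have h : Function.Bijective ((Module.evalEquiv K N) ≪≫ₗ
    (toDual τ N).dualMap ≪≫ₗ (toDual (opSymm τ) (kDual τ N)).symm) := LinearEquiv.bijective _
  exact (ConcreteCategory.isIso_iff_bijective _).2 h

end kDual

lemma ExtVanish.kDual {i : ℕ} (h : ExtVanish N (kDual (opSymm τ) X) i) (hi : 1 ≤ i) :
    ExtVanish X (kDual τ N) i := by
  induction i, hi using Nat.le_induction generalizing N with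
  | base =>
    obtain ⟨L, P, j, q, hN, _⟩ := exists_projective_isShortExact N
    refine (kDual.isShortExact_map hN).extVanish_one_of_exists_lift
      (extVanish_of_injective le_rfl) fun a => ?_
    obtain ⟨b, hb⟩ := hN.exists_extension h (kDual.flip (τ := opSymm τ) a)
    refine ⟨kDual.flip b, ModuleCat.hom_ext (LinearMap.ext fun x => kDual.ext fun n => ?_)⟩
    exact DFunLike.congr_fun (congrArg (· n) hb) x
  | succ i hi ih =>
    obtain ⟨L, P, j, q, hN, _⟩ := exists_projective_isShortExact N
    exact (kDual.isShortExact_map hN).extVanish_covariant₁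
      (ih (hN.extVanish_contravariant₁ (extVanish_of_projective hi) h))
      (extVanish_of_injective (by lia))

variable [FiniteDimensional K R]

lemma extVanish_kDual_iff [Module.Finite R N'] {i : ℕ} (hi : 1 ≤ i) :
    ExtVanish (kDual τ N') (kDual τ N) i ↔ ExtVanish N N' i :=
  ⟨fun h => (h.kDual (τ := opSymm τ) hi).of_retract_right (.ofIso (asIso (kDual.eval τ N'))),
    fun h => (h.of_retract_right (.ofIso (asIso (kDual.eval τ N')).symm)).kDual hi⟩

lemma ExtVanish.kDual_left [FiniteDimensional K S] [Module.Finite R N] [Module.Finite S X] {i : ℕ}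
    (h : ExtVanish (GorDom.kDual τ N) X i) (hi : 1 ≤ i) :
    ExtVanish (GorDom.kDual (opSymm τ) X) N i :=
  ((extVanish_kDual_iff hi).2 h).of_retract_right (.ofIso (asIso (kDual.eval τ N)))

lemma exists_mono_kDual_pi (τ : S ≃ₐ[K] Rᵐᵒᵖ) (N : ModuleCat.{u} R) [Module.Finite R N] :
    ∃ (n : ℕ) (j : N ⟶ kDual (opSymm τ) (ModuleCat.of S (Fin n → S))), Mono j := by
  have := kDual.finite τ N
  obtain ⟨n, p, hp⟩ := Module.Finite.exists_fin' S (kDual τ N)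
  let q : ModuleCat.of S (Fin n → S) ⟶ kDual τ N := ModuleCat.ofHom (Y := kDual τ N) p
  have : Epi q := (ModuleCat.epi_iff_surjective q).2 hp
  have : Mono (kDual.map (opSymm τ) q) :=
    (kDual.isShortExact_map (isShortExact_subtype q)).mono
  exact ⟨n, kDual.eval τ N ≫ kDual.map (opSymm τ) q, mono_comp _ _⟩

lemma enoughFiniteInjectives_of_finiteDimensional (K R : Type u) [Field K] [Ring R] [Algebra K R]
    [FiniteDimensional K R] : EnoughFiniteInjectives R where
  exists_mono M _ := by
    have : FiniteDimensional K Rᵐᵒᵖ := inferInstance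
    obtain ⟨n, j, hj⟩ := exists_mono_kDual_pi (AlgEquiv.refl : Rᵐᵒᵖ ≃ₐ[K] Rᵐᵒᵖ) M
    obtain ⟨_, _⟩ := fgProjective_pi (R := Rᵐᵒᵖ) n
    exact ⟨_, j, hj, kDual.finite _ _, inferInstance⟩

end Duality

section GorensteinProjective

variable {A : Type u} [Ring A] {M P X : ModuleCat.{u} Aᵐᵒᵖ} {d n : ℕ}

lemma ExtVanish.of_rightRegular {i : ℕ} (h : ExtVanish X (rightRegular A) i)
    (hP : fgProjective Aᵐᵒᵖ P) : ExtVanish X P i :=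
  (h.of_retract_right (.ofIso (unopLinearEquiv A).toModuleIso)).of_fgProjective hP

lemma HasDominantDimensionGE.of_rightRegular (h : HasDominantDimensionGE (rightRegular A) n)
    (hP : fgProjective Aᵐᵒᵖ P) : HasDominantDimensionGE P n :=
  fun T hT i hi => (h T hT i hi).of_rightRegular hP

lemma mem_dom_iff [IsArtinianRing Aᵐᵒᵖ] [EnoughFiniteInjectives Aᵐᵒᵖ] :
    Dom A d M ↔ Module.Finite Aᵐᵒᵖ M ∧ HasDominantDimensionGE M d :=
  and_congr_right fun _ => ⟨hasDominantDimensionGE_of_le_domdim, fun h => h.le_domdim⟩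

lemma IsGProj.hasDominantDimensionGE [IsNoetherianRing A] (hM : IsGProj M)
    (hA : HasDominantDimensionGE (rightRegular A) d) : HasDominantDimensionGE M d := by
  obtain ⟨C, -, hCM⟩ := hM.exists_isSyzygy d
  rw [← zero_add d] at hA ⊢
  exact hCM.hasDominantDimensionGE (fun P hP => hA.of_rightRegular hP)
    fun _ _ i hi => absurd hi i.not_lt_zero

lemma HasDominantDimensionGE.extVanish_rightRegular [IsArtinianRing Aᵐᵒᵖ]
    [EnoughFiniteInjectives Aᵐᵒᵖ] [Module.Finite Aᵐᵒᵖ M] (hM : HasDominantDimensionGE M d)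
    (hA : HasInjectiveDimensionLE (rightRegular A) d) {i : ℕ} (hi : 1 ≤ i) :
    ExtVanish M (rightRegular A) i := by
  rw [← zero_add d] at hM
  obtain ⟨X, -, -, hXM⟩ := hM.exists_isSyzygy
  exact (hXM.extVanish_left_iff (fun P hP _ => hP.1.extVanish) hi).2
    (extVanish_of_hasInjectiveDimensionLT hA (by lia))

lemma IsPresentation.trVanish [IsNoetherianRing Aᵐᵒᵖ] {P₁ P₀ : ModuleCat.{u} Aᵐᵒᵖ} {f : P₁ ⟶ P₀}
    {π : P₀ ⟶ M} (h : IsPresentation f π) (hM : ∀ i, 1 ≤ i → ExtVanish M (rightRegular A) i)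
    (hA : HasInjectiveDimensionLE (leftRegular A) d) : TrVanish f := by
  intro i hi
  obtain ⟨T, hT⟩ := h.exists_isSyzygy_Tr hM d
  exact (hT.extVanish_left_iff (fun P hP _ => hP.extVanish) hi).2
    (extVanish_of_hasInjectiveDimensionLT hA (by lia))

lemma mem_gp_of_forall_extVanish [IsArtinianRing Aᵐᵒᵖ] (hM : Module.Finite Aᵐᵒᵖ M)
    (hExt : ∀ i, 1 ≤ i → ExtVanish M (rightRegular A) i)
    (hA : HasInjectiveDimensionLE (leftRegular A) d) : Gp A M := by
  obtain ⟨p⟩ := nonempty_minimalPresentation (M := M)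
  have hp : IsPresentation (ModuleCat.ofHom p.f) (ModuleCat.ofHom p.π) :=
    ⟨p.fgProjective₁, p.fgProjective₀, LinearMap.exact_iff.2 p.exact.symm, p.surjective⟩
  exact ⟨hM, hExt, p, hp.trVanish hExt hA⟩

theorem gp_eq_dom [IsNoetherianRing A] [IsArtinianRing Aᵐᵒᵖ] [EnoughFiniteInjectives Aᵐᵒᵖ]
    (hd : HasDominantDimensionGE (rightRegular A) d)
    (hl : HasInjectiveDimensionLE (leftRegular A) d)
    (hr : HasInjectiveDimensionLE (rightRegular A) d) : Gp A = Dom A d := by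
  refine le_antisymm (fun M hM => ?_) fun M hM => ?_
  · exact mem_dom_iff.2 ⟨hM.1, (isGProj_of_mem_Gp hM).hasDominantDimensionGE hd⟩
  · obtain ⟨hMf, hMd⟩ := mem_dom_iff.1 hM
    exact mem_gp_of_forall_extVanish hMf (fun i hi => hMd.extVanish_rightRegular hr hi) hl

lemma exists_isGProj_isSyzygy [IsArtinianRing Aᵐᵒᵖ] [EnoughFiniteInjectives Aᵐᵒᵖ]
    (hd : HasDominantDimensionGE (rightRegular A) d) (h : Dom A d ≤ Gp A)
    (X : ModuleCat.{u} Aᵐᵒᵖ) [Module.Finite Aᵐᵒᵖ X] :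
    ∃ Y, IsGProj Y ∧ IsSyzygy (fgProjective Aᵐᵒᵖ) d X Y := by
  obtain ⟨Y, hY, hXY⟩ := exists_isSyzygy_fgProjective d X
  refine ⟨Y, isGProj_of_mem_Gp (h _ (mem_dom_iff.2 ⟨hY, ?_⟩)), hXY⟩
  rw [← zero_add d] at hd ⊢
  exact hXY.hasDominantDimensionGE (fun P hP => hd.of_rightRegular hP)
    fun _ _ i hi => absurd hi i.not_lt_zero

theorem hasInjectiveDimensionLE_rightRegular_of_dom_le_gp [IsArtinianRing Aᵐᵒᵖ]
    [EnoughFiniteInjectives Aᵐᵒᵖ]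
    (hd : HasDominantDimensionGE (rightRegular A) d) (h : Dom A d ≤ Gp A) :
    HasInjectiveDimensionLE (rightRegular A) d := by
  refine hasInjectiveDimensionLE_of_forall_finite fun X _ => ?_
  obtain ⟨Y, hY, hXY⟩ := exists_isGProj_isSyzygy hd h X
  rw [add_comm]
  exact (hXY.extVanish_left_iff (fun P hP _ => hP.extVanish) le_rfl).1 (hY.extVanish 1 le_rfl)

/- `M` embeds into a projective module with cokernel `C`, and the sequence splits: `C` is itself an
`n`-th syzygy of some `C'`, so that `Ext¹(C, M) ≅ Ext¹⁺ⁿ(C', M) ≅ Ext¹(C', E) = 0`. -/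
lemma IsGProj.projective_of_isSyzygy_injective [IsNoetherianRing A] {E : ModuleCat.{u} Aᵐᵒᵖ}
    [Injective E] (hM : IsGProj M) (hEM : IsSyzygy (fgProjective Aᵐᵒᵖ) n E M) : Projective M := by
  obtain ⟨F, C, j, q, hjq, hF, hC⟩ := hM.exists_cosyzygy
  obtain ⟨C', hC', hC'C⟩ := hC.exists_isSyzygy n
  have hExt : ExtVanish C' M (1 + n) := (hEM.extVanish_right_iff
    (fun P hP i hi => (hC'.extVanish i hi).of_rightRegular hP) le_rfl).1
    (extVanish_of_injective le_rfl)
  obtain ⟨r⟩ := hjq.nonempty_retract ((hC'C.extVanish_left_iff (fun P hP _ =>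
    hP.extVanish) le_rfl).2 hExt)
  have := hF.2
  exact r.projective

lemma not_hasInjectiveDimensionLT_of_algDomdim [IsArtinianRing Aᵐᵒᵖ]
    [EnoughFiniteInjectives Aᵐᵒᵖ] (hd : 1 ≤ d) (hA : algDomdim A = d) :
    ¬ HasInjectiveDimensionLT (rightRegular A) d := by
  intro h
  obtain ⟨n, rfl⟩ := Nat.exists_eq_add_of_le' hd
  have : Module.Finite Aᵐᵒᵖ (rightRegular A) := .equiv (unopLinearEquiv A)
  have hdom := (hasDominantDimensionGE_of_le_domdim hA.ge).of_hasInjectiveDimensionLE h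
  exact absurd (Nat.cast_le.1 ((hdom (n + 2)).le_domdim.trans hA.le)) (by lia)

end GorensteinProjective

section FiniteDimensionalAlgebra

variable (K : Type u) {A : Type u} [Field K] [Ring A] [Algebra K A] [FiniteDimensional K A]
  {d n m : ℕ}

include K in
theorem hasInjectiveDimensionLE_leftRegular_of_dom_le_gp
    (hd : HasDominantDimensionGE (rightRegular A) d) (h : Dom A d ≤ Gp A) :
    HasInjectiveDimensionLE (leftRegular A) d := by
  have : IsNoetherianRing A := .of_finite K A
  have : IsArtinianRing Aᵐᵒᵖ := .of_finite K Aᵐᵒᵖ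
  have := enoughFiniteInjectives_of_finiteDimensional K Aᵐᵒᵖ
  let D := kDual (AlgEquiv.refl : Aᵐᵒᵖ ≃ₐ[K] Aᵐᵒᵖ)
  have : Module.Finite Aᵐᵒᵖ (D (leftRegular A)) := kDual.finite _ _
  obtain ⟨Y, hY, hDY⟩ := exists_isGProj_isSyzygy hd h (D (leftRegular A))
  have : Injective (D (leftRegular A)) :=
    have : Projective (leftRegular A) := (IsProjective.iff_projective A).1 inferInstance
    kDual.injective
  have : Projective Y := hY.projective_of_isSyzygy_injective hDY
  refine hasInjectiveDimensionLE_of_forall_finite fun Z _ => ?_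
  rw [← extVanish_kDual_iff (τ := (AlgEquiv.refl : Aᵐᵒᵖ ≃ₐ[K] Aᵐᵒᵖ)) (by lia), add_comm]
  exact (hDY.extVanish_left_iff (fun P hP _ => hP.extVanish) le_rfl).1
    (extVanish_of_projective le_rfl)

include K in
lemma fgInjective.extVanish_rightRegular {J : ModuleCat.{u} Aᵐᵒᵖ} (hJ : fgInjective Aᵐᵒᵖ J)
    (hA : HasInjectiveDimensionLE (leftRegular A) n) {i : ℕ} (hi : n < i) :
    ExtVanish J (rightRegular A) i := by
  obtain ⟨_, _⟩ := hJ
  have : Module.Finite Aᵐᵒᵖ (rightRegular A) := .equiv (unopLinearEquiv A)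
  let τ : A ≃ₐ[K] Aᵐᵒᵖᵐᵒᵖ := opSymm .refl
  obtain ⟨k, j, _⟩ := exists_mono_kDual_pi τ J
  have hj : ExtVanish (kDual (opSymm τ) (ModuleCat.of A (Fin k → A))) (rightRegular A) i :=
    ((extVanish_of_hasInjectiveDimensionLT hA hi).pi_right k).kDual_left (by lia)
  exact hj.of_retract_left ⟨j, Injective.factorThru (𝟙 J) j, Injective.comp_factorThru _ _⟩

include K in
theorem hasInjectiveDimensionLE_rightRegular_of_leftRegular
    (hl : HasInjectiveDimensionLE (leftRegular A) n)
    (hr : HasInjectiveDimensionLE (rightRegular A) m) :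
    HasInjectiveDimensionLE (rightRegular A) n := by
  have := enoughFiniteInjectives_of_finiteDimensional K Aᵐᵒᵖ
  have : Module.Finite Aᵐᵒᵖ (rightRegular A) := .equiv (unopLinearEquiv A)
  induction m with
  | zero => exact hasInjectiveDimensionLT_of_ge _ 1 _ (by lia)
  | succ m ih =>
    obtain hmn | hnm := le_or_gt (m + 1) n
    · exact hasInjectiveDimensionLT_of_ge _ (m + 2) _ (by lia)
    · exact ih (hasInjectiveDimensionLE_of_forall_fgInjective hr fun J hJ =>
        hJ.extVanish_rightRegular K hl hnm)

end FiniteDimensionalAlgebra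

section SmallField

lemma exists_algebra_of_subsingleton (A : Type u) [Ring A] [Subsingleton A] :
    ∃ (k : Type u) (_ : Field k), Nonempty (Algebra k A) :=
  let φ : ULift.{u} ℚ →+* A :=
    { toFun := fun _ => 0
      map_one' := Subsingleton.elim _ _
      map_mul' := fun _ _ => Subsingleton.elim _ _
      map_zero' := rfl
      map_add' := fun _ _ => Subsingleton.elim _ _ }
  ⟨ULift.{u} ℚ, inferInstance, ⟨φ.toAlgebra' fun _ _ => Subsingleton.elim _ _⟩⟩

theorem exists_small_field (K : Type v) (A : Type u) [Field K] [Ring A] [Algebra K A]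
    [FiniteDimensional K A] :
    ∃ (k : Type u) (_ : Field k) (_ : Algebra k A), FiniteDimensional k A := by
  cases subsingleton_or_nontrivial A with
  | inl _ =>
    obtain ⟨k, _, ⟨_⟩⟩ := exists_algebra_of_subsingleton A
    exact ⟨k, inferInstance, inferInstance, inferInstance⟩
  | inr _ =>
    have : Small.{u} K := small_of_injective (algebraMap K A).injective
    let e : Shrink.{u} K ≃+* K := Shrink.ringEquiv K
    let _ : Algebra (Shrink.{u} K) A := Algebra.compHom A e.toRingHom
    refine ⟨Shrink.{u} K, inferInstance, inferInstance, ?_⟩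
    let f : A →ₛₗ[(e.symm : K →+* Shrink.{u} K)] A :=
      { toFun := id
        map_add' := fun _ _ => rfl
        map_smul' := fun a x => congrArg (· • x) (e.apply_symm_apply a).symm }
    exact Module.Finite.of_surjective f Function.surjective_id

end SmallField

theorem gp_eq_dom_iff (K : Type u) {A : Type u} [Field K] [Ring A] [Algebra K A]
    [FiniteDimensional K A] (d : ℕ) (hd : 1 ≤ d) (hA : algDomdim A = d) :
    Gp A = Dom A d ↔ IsGorensteinOfDim A d := by
  have : IsNoetherianRing A := .of_finite K A
  have : IsArtinianRing Aᵐᵒᵖ := .of_finite K Aᵐᵒᵖ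
  have := enoughFiniteInjectives_of_finiteDimensional K Aᵐᵒᵖ
  have hdom := hasDominantDimensionGE_of_le_domdim hA.ge
  constructor
  · intro h
    have hr := hasInjectiveDimensionLE_rightRegular_of_dom_le_gp hdom h.ge
    have hl := hasInjectiveDimensionLE_leftRegular_of_dom_le_gp K hdom h.ge
    have hr' := not_hasInjectiveDimensionLT_of_algDomdim hd hA
    have hl' : ¬ HasInjectiveDimensionLT (leftRegular A) d := by
      obtain ⟨n, rfl⟩ := Nat.exists_eq_add_of_le' hd
      exact fun hl => hr' (hasInjectiveDimensionLE_rightRegular_of_leftRegular K hl hr)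
    exact ⟨le_antisymm ((injectiveDimension_le_iff _ _).2 hl)
        ((injectiveDimension_ge_iff _ _).2 hl'),
      le_antisymm ((injectiveDimension_le_iff _ _).2 hr) ((injectiveDimension_ge_iff _ _).2 hr')⟩
  · rintro ⟨hl, hr⟩
    exact gp_eq_dom hdom ((injectiveDimension_le_iff _ _).1 hl.le)
      ((injectiveDimension_le_iff _ _).1 hr.le)

end GorDom

theorem mainTheorem8 {K : Type v} {A : Type u} [Field K] [Ring A] [Algebra K A]
    [FiniteDimensional K A] (d : ℕ) (hd : 1 ≤ d) (hA : GorDom.algDomdim A = d) :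
    GorDom.Gp A = GorDom.Dom A d ↔ GorDom.IsGorensteinOfDim A d := by
  obtain ⟨k, _, _, _⟩ := GorDom.exists_small_field K A
  exact GorDom.gp_eq_dom_iff k d hd hA
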